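/- **Theorem.** Let $G$ be a finite-dimensional Lie group with Lie algebra $\mathfrak g$, let $\pi:P\to M$ be a smooth principal $G$-bundle over a finite-dimensional smooth manifold $M$ with a connection $A$ (no assumption on its curvature is needed; in particular $A$ may be flat), let $n\ge 1$, and let $B$ be a smooth $\mathfrak g$-valued $(n+1)$-form on $M$ of adjoint type (that is, with values in $\mathrm{ad}\,P$). Fix $x_0\in M$ and a frame $u_0\in P_{x_0}$. For $k\ge1$ let $\Omega^{k}(M,x_0)$ be the set of smooth maps $[0,2\pi]^{k}\to M$ that send $\partial[0,2\pi]^{k}$ to $x_0$. For $N\in\Omega^n(M,x_0)$ and $\sigma\in[0,2\pi]^n$ let $W_\sigma$ denote $A$-parallel transport from $x_0$ to $N(\sigma)$ along $s\mapsto N(s,\sigma^2,\dots,\sigma^n)$, $0\le s\le\sigma^1$. (For $n=1$ this is transport along the loop itself; if $A$ is flat, then any other choice of paths in the cube from the boundary to $\sigma$ gives the same $W_\sigma$, and if moreover $M$ is simply connected, so does any path in $M$ from $x_0$ to $N(\sigma)$.) The loop space connection $\mathcal A$ on $\Omega^n(M,x_0)$ is the $\mathfrak g$-valued $1$-form $$\mathcal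 A_N(X)=\int_{[0,2\pi]^n} W_\sigma^{-1}\,B_{N(\sigma)}\bigl(X(\sigma),\partial_{1}N(\sigma),\dots,\partial_{n}N(\sigma)\bigr)\,W_\sigma\;d^n\sigma ,$$ where $X$ is a vector field along $N$. A map $\gamma\in\Omega^{n+1}(M,x_0)$ is regarded as a loop $\tau\mapsto\gamma_\tau=\gamma(\cdot,\tau)$ in $\Omega^n(M,x_0)$ based at the constant map $x_0$. Its holonomy is $\mathrm{hol}(\gamma)=W(2\pi)\in G$, where $$\frac{dW}{d\tau}+\mathcal A_{\gamma_\tau}(\partial_\tau\gamma)\,W=0,\qquad W(0)=1 .$$ The holonomy group of $\mathcal A$ is the subgroup of $G$ generated by all $\mathrm{hol}(\gamma)$, $\gamma\in\Omega^{n+1}(M,x_0)$. Call $\mathcal A$ *$r$-flat* if $\mathrm{hol}(\gamma\circ f)=\mathrm{hol}(\gamma)$ for every $\gamma\in\Omega^{n+1}(M,x_0)$ and every diffeomorphism $f$ of $[0,2\pi]^{n+1}$ that is the identity on the boundary and is connected to the identity by a smooth path of such diffeomorphisms. If $\mathcal A$ is $r$-flat, then its holonomy group is abelian. -/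

import Mathlib

open Set MeasureTheory
open scoped Manifold ContDiff

noncomputable section

namespace LoopHolonomy

/-! ### Principal bundles, connections and forms of adjoint type

All manifolds are smooth, modelled on real normed spaces and without boundary. The Lie algebra of a
Lie group `G` modelled on `EG` is its tangent space `T₁G`, which is by definition the vector space
`EG`. -/

section Bundle

variable {EM : Type*} [NormedAddCommGroup EM] [NormedSpace ℝ EM]
  {EP : Type*} [NormedAddCommGroup EP] [NormedSpace ℝ EP]
  {EG : Type*} [NormedAddCommGroup EG] [NormedSpace ℝ EG]

/-- The adjoint action `Ad g` of a Lie group on its Lie algebra: the derivative at `1` of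
conjugation by `g`. -/
def Ad {G : Type*} [TopologicalSpace G] [ChartedSpace EG G] [Group G] (g : G) : EG →L[ℝ] EG :=
  mfderiv 𝓘(ℝ, EG) 𝓘(ℝ, EG) (fun h : G => g * h * g⁻¹) 1

/-- The right invariant vector field `ξ g` on `G` with value `ξ` at the identity. -/
def rightInvariant {G : Type*} [TopologicalSpace G] [ChartedSpace EG G] [Group G]
    (ξ : EG) (g : G) : TangentSpace 𝓘(ℝ, EG) g :=
  mfderiv 𝓘(ℝ, EG) 𝓘(ℝ, EG) (fun h : G => h * g) 1 ξ

/-- A smooth principal `G`-bundle `proj : P → M` with right action `act`. -/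
structure PrincipalBundle
    (M : Type*) [TopologicalSpace M] [ChartedSpace EM M]
    (P : Type*) [TopologicalSpace P] [ChartedSpace EP P]
    (G : Type*) [TopologicalSpace G] [ChartedSpace EG G] [Group G] where
  /-- the bundle projection -/
  proj : P → M
  /-- the right action of the structure group -/
  act : P → G → P
  contMDiff_proj : ContMDiff 𝓘(ℝ, EP) 𝓘(ℝ, EM) ∞ proj
  contMDiff_act :
    ContMDiff (𝓘(ℝ, EP).prod 𝓘(ℝ, EG)) 𝓘(ℝ, EP) ∞ (fun q : P × G => act q.1 q.2)
  act_one : ∀ u, act u 1 = u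
  act_mul : ∀ u g h, act u (g * h) = act (act u g) h
  proj_act : ∀ u g, proj (act u g) = proj u
  /-- Over a neighbourhood `U` of every point there is a smooth section `s` for which
  `(y, g) ↦ act (s y) g` is a diffeomorphism of `U × G` onto `proj ⁻¹' U`,
  with inverse `u ↦ (proj u, ψ u)`. -/
  locally_trivial : ∀ x : M, ∃ U : Set M, IsOpen U ∧ x ∈ U ∧ ∃ (s : M → P) (ψ : P → G),
    ContMDiffOn 𝓘(ℝ, EM) 𝓘(ℝ, EP) ∞ s U ∧
    ContMDiffOn 𝓘(ℝ, EP) 𝓘(ℝ, EG) ∞ ψ (proj ⁻¹' U) ∧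
    (∀ y ∈ U, proj (s y) = y) ∧
    (∀ y ∈ U, ∀ g, ψ (act (s y) g) = g) ∧
    (∀ u ∈ proj ⁻¹' U, act (s (proj u)) (ψ u) = u)

variable
  {M : Type*} [TopologicalSpace M] [ChartedSpace EM M]
  {P : Type*} [TopologicalSpace P] [ChartedSpace EP P]
  {G : Type*} [TopologicalSpace G] [ChartedSpace EG G] [Group G]

/-- A connection on a principal bundle, given by its connection form: a smooth Lie algebra valued
`1`-form on `P`, equivariant under the right action and equal to the Maurer-Cartan form on the
fibres. -/
structure Connection [IsManifold 𝓘(ℝ, EP) ∞ P]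
    (𝓟 : PrincipalBundle (EM := EM) (EP := EP) (EG := EG) M P G) where
  /-- the connection form -/
  form : ∀ u : P, TangentSpace 𝓘(ℝ, EP) u →L[ℝ] EG
  contMDiff_form : ContMDiff 𝓘(ℝ, EP).tangent 𝓘(ℝ, EG) ∞
    (fun v : TangentBundle 𝓘(ℝ, EP) P => form v.proj v.snd)
  form_vertical : ∀ (u : P) (ξ : EG),
    form u (mfderiv 𝓘(ℝ, EG) 𝓘(ℝ, EP) (fun g : G => 𝓟.act u g) 1 ξ) = ξ
  form_equivariant : ∀ (u : P) (g : G) (v : TangentSpace 𝓘(ℝ, EP) u),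
    form (𝓟.act u g) (mfderiv 𝓘(ℝ, EP) 𝓘(ℝ, EP) (fun p : P => 𝓟.act p g) u v) =
      Ad g⁻¹ (form u v)

/-- A smooth Lie algebra valued `k`-form on `M` that transforms in the adjoint representation under
gauge transformations: to every frame `u : P` over `x : M` it assigns an alternating `k`-linear form
on `T_xM`, and changing `u` to `act u g` changes this form by `Ad g⁻¹`. Smoothness is smoothness of
the components with respect to the coordinate frames of `TM`, as functions on `P`. -/
structure AdForm [IsManifold 𝓘(ℝ, EM) ∞ M]
    (𝓟 : PrincipalBundle (EM := EM) (EP := EP) (EG := EG) M P G) (k : ℕ) where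
  /-- the value of the form in the frame `u` -/
  toFun : ∀ u : P, (TangentSpace 𝓘(ℝ, EM) (𝓟.proj u)) [⋀^Fin k]→L[ℝ] EG
  equivariant : ∀ (u : P) (g : G) (v : Fin k → TangentSpace 𝓘(ℝ, EM) (𝓟.proj u)),
    toFun (𝓟.act u g) v = Ad g⁻¹ (toFun u v)
  smooth : ∀ x : M, ContMDiffOn 𝓘(ℝ, EP) 𝓘(ℝ, EM [⋀^Fin k]→L[ℝ] EG) ∞
    (fun u : P => (toFun u).compContinuousLinearMap
      ((trivializationAt EM (TangentSpace 𝓘(ℝ, EM)) x).symmL ℝ (𝓟.proj u)))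
    (𝓟.proj ⁻¹' (chartAt EM x).source)

end Bundle

/-! ### Spherical loop spaces and reparametrizations -/

/-- The cube `[0, 2π]ⁿ`. -/
def cube (n : ℕ) : Set (Fin n → ℝ) := Icc 0 (fun _ => 2 * Real.pi)

/-- The boundary of the cube. -/
def cubeBoundary (n : ℕ) : Set (Fin n → ℝ) :=
  {σ | σ ∈ cube n ∧ ∃ i, σ i = 0 ∨ σ i = 2 * Real.pi}

/-- `Ωⁿ(M, x₀)`: smooth maps `[0, 2π]ⁿ → M` that send the boundary to `x₀`. An element is
represented by a function on `ℝⁿ` whose values outside the cube are irrelevant. -/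
def LoopSpace {EM : Type*} [NormedAddCommGroup EM] [NormedSpace ℝ EM]
    {M : Type*} [TopologicalSpace M] [ChartedSpace EM M] (x₀ : M) (n : ℕ) :
    Set ((Fin n → ℝ) → M) :=
  {N | ContMDiffOn 𝓘(ℝ, Fin n → ℝ) 𝓘(ℝ, EM) ∞ N (cube n) ∧ ∀ σ ∈ cubeBoundary n, N σ = x₀}

/-- `f` restricts to a diffeomorphism of the cube that is the identity on the boundary. -/
def IsCubeDiffeo {n : ℕ} (f : (Fin n → ℝ) → (Fin n → ℝ)) : Prop :=
  ContDiffOn ℝ ∞ f (cube n) ∧ MapsTo f (cube n) (cube n) ∧ (∀ σ ∈ cubeBoundary n, f σ = σ) ∧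
    ∃ h : (Fin n → ℝ) → (Fin n → ℝ), ContDiffOn ℝ ∞ h (cube n) ∧ MapsTo h (cube n) (cube n) ∧
      (∀ σ ∈ cube n, h (f σ) = σ) ∧ (∀ σ ∈ cube n, f (h σ) = σ)

/-- `f` is a diffeomorphism of the cube, equal to the identity on the boundary, that is connected to
the identity by a smooth path of such diffeomorphisms. -/
def IsReparametrization {n : ℕ} (f : (Fin n → ℝ) → (Fin n → ℝ)) : Prop :=
  ∃ F : ℝ → (Fin n → ℝ) → (Fin n → ℝ),
    ContDiffOn ℝ ∞ (fun q : ℝ × (Fin n → ℝ) => F q.1 q.2) (Icc 0 1 ×ˢ cube n) ∧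
    (∀ t ∈ Icc (0 : ℝ) 1, IsCubeDiffeo (F t)) ∧
    (∀ σ ∈ cube n, F 0 σ = σ) ∧ (∀ σ ∈ cube n, F 1 σ = f σ)

/-! ### The connection on the loop space and its holonomy -/

section Holonomy

variable {EM : Type*} [NormedAddCommGroup EM] [NormedSpace ℝ EM]
  {EP : Type*} [NormedAddCommGroup EP] [NormedSpace ℝ EP]
  {EG : Type*} [NormedAddCommGroup EG] [NormedSpace ℝ EG]
  {M : Type*} [TopologicalSpace M] [ChartedSpace EM M] [IsManifold 𝓘(ℝ, EM) ∞ M]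
  {P : Type*} [TopologicalSpace P] [ChartedSpace EP P] [IsManifold 𝓘(ℝ, EP) ∞ P]
  {G : Type*} [TopologicalSpace G] [ChartedSpace EG G] [Group G]
  {𝓟 : PrincipalBundle (EM := EM) (EP := EP) (EG := EG) M P G}

/-- `u` is a horizontal lift to `P` of the curve `c : [0, 2π] → M`, that is, `u` is the parallel
transport of `u 0` along `c`. -/
def IsHorizontalLift (A : Connection 𝓟) (c : ℝ → M) (u : ℝ → P) : Prop :=
  ∀ s ∈ Icc (0 : ℝ) (2 * Real.pi), 𝓟.proj (u s) = c s ∧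
    MDifferentiableWithinAt 𝓘(ℝ, ℝ) 𝓘(ℝ, EP) u (Icc 0 (2 * Real.pi)) s ∧
    A.form (u s)
      (mfderivWithin 𝓘(ℝ, ℝ) 𝓘(ℝ, EP) u (Icc 0 (2 * Real.pi)) s (1 : ℝ)) = 0

/-- For `N ∈ Ωⁿ(M, x₀)` and a frame `u₀` over `x₀`: the function `u` gives at every `σ` of the cube
the frame over `N σ` obtained from `u₀` by parallel transport along the path
`s ↦ N (s, σ², …, σⁿ)`, `0 ≤ s ≤ σ¹`, which leads from `x₀` to `N σ`. For `n = 1` this path is the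
loop itself. -/
def IsTransportedFrame (A : Connection 𝓟) (u₀ : P) {n : ℕ} [NeZero n] (N : (Fin n → ℝ) → M)
    (u : (Fin n → ℝ) → P) : Prop :=
  ∀ σ ∈ cube n, u (Function.update σ 0 0) = u₀ ∧
    IsHorizontalLift A (fun s => N (Function.update σ 0 s)) (fun s => u (Function.update σ 0 s))

/-- The value `𝓐(X) = ∫_N ι_X B^W` of the loop space connection at `N ∈ Ωⁿ(M, x₀)` on the tangent
vector `X` (a vector field along `N`). Evaluating `B` in the transported frame `u σ` amounts to
transporting its value at `N σ` back to `x₀`. -/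
def loopConnection {n : ℕ} (B : AdForm 𝓟 (n + 1)) (N : (Fin n → ℝ) → M)
    (u : (Fin n → ℝ) → P) (X : (Fin n → ℝ) → EM) : EG :=
  ∫ σ in cube n, B.toFun (u σ) (Fin.cons (X σ) (fun i : Fin n =>
    mfderivWithin 𝓘(ℝ, Fin n → ℝ) 𝓘(ℝ, EM) N (cube n) σ (Pi.single i (1 : ℝ))) :
      Fin (n + 1) → EM)

/-- The member `γ_τ` at time `τ` of the loop of `n`-loops `γ : [0, 2π]ⁿ × [0, 2π] → M`. -/
def slice {n : ℕ} (γ : (Fin (n + 1) → ℝ) → M) (τ : ℝ) : (Fin n → ℝ) → M :=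
  fun σ => γ (Fin.snoc σ τ)

/-- The velocity `∂γ/∂τ` of a loop of `n`-loops, a vector field along `γ_τ`. -/
def velocity {n : ℕ} (γ : (Fin (n + 1) → ℝ) → M) (τ : ℝ) : (Fin n → ℝ) → EM :=
  fun σ => mfderivWithin 𝓘(ℝ, Fin (n + 1) → ℝ) 𝓘(ℝ, EM) γ (cube (n + 1)) (Fin.snoc σ τ)
    (Pi.single (Fin.last n) (1 : ℝ))

/-- `g` is the holonomy of the loop connection `𝓐` along `γ ∈ Ωⁿ⁺¹(M, x₀)`, regarded as a loop
`τ ↦ γ_τ` in `Ωⁿ(M, x₀)` based at the constant loop: `g = W(2π)` for the solution of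
`dW/dτ + 𝓐(∂γ/∂τ) W = 0`, `W(0) = 1`. -/
def IsHolonomy (A : Connection 𝓟) {n : ℕ} [NeZero n] (B : AdForm 𝓟 (n + 1)) (u₀ : P)
    (γ : (Fin (n + 1) → ℝ) → M) (g : G) : Prop :=
  ∃ (u : ℝ → (Fin n → ℝ) → P) (W : ℝ → G),
    (∀ τ ∈ Icc (0 : ℝ) (2 * Real.pi), IsTransportedFrame A u₀ (slice γ τ) (u τ)) ∧
    W 0 = 1 ∧
    (∀ τ ∈ Icc (0 : ℝ) (2 * Real.pi),
      HasMFDerivWithinAt 𝓘(ℝ, ℝ) 𝓘(ℝ, EG) W (Icc 0 (2 * Real.pi)) τ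
        ((1 : ℝ →L[ℝ] ℝ).smulRight
          (rightInvariant (-loopConnection B (slice γ τ) (u τ) (velocity γ τ)) (W τ)))) ∧
    W (2 * Real.pi) = g

/-- The loop connection is `r`-flat (reparametrization flat): the holonomies of `γ` and of
`γ ∘ f` agree for every `γ ∈ Ωⁿ⁺¹(M, x₀)` and every reparametrization `f` of the cube. -/
def IsRFlat (A : Connection 𝓟) {n : ℕ} [NeZero n] (B : AdForm 𝓟 (n + 1)) (u₀ : P) : Prop :=
  ∀ γ ∈ LoopSpace (EM := EM) (𝓟.proj u₀) (n + 1), ∀ f : (Fin (n + 1) → ℝ) → (Fin (n + 1) → ℝ),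
    IsReparametrization f → ∀ g g' : G,
      IsHolonomy A B u₀ γ g → IsHolonomy A B u₀ (γ ∘ f) g' → g = g'

/-- The holonomy group of the loop connection: the subgroup of `G` generated by the holonomies of
all loops in `Ωⁿ(M, x₀)` based at the constant loop. -/
def holonomyGroup (A : Connection 𝓟) {n : ℕ} [NeZero n] (B : AdForm 𝓟 (n + 1)) (u₀ : P) :
    Subgroup G :=
  Subgroup.closure
    {g | ∃ γ ∈ LoopSpace (EM := EM) (𝓟.proj u₀) (n + 1), IsHolonomy A B u₀ γ g}

end Holonomy

end LoopHolonomy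

end

/-!
The argument is that of Eckmann and Hilton for the commutativity of higher homotopy groups, applied
to the spherical loops `γ₁, γ₂ ∈ Ωⁿ⁺¹(M, x₀)` with holonomies `g₁, g₂`.

*Slowing down.* Precomposing `γ` with a product of profiles (smooth monotone self-maps of `[0, 2π]`
that may be constant near the ends) makes it constant near the boundary. Such a product is not a
diffeomorphism, so `r`-flatness says nothing about it, but the holonomy is unchanged for elementary
reasons: transported frames pull back along it (`IsTransportedFrame.comp`), the integral defining
the loop connection is multiplied by the speed in time, by multilinearity and the change of
variables formula (`FollowsAt.loopConnection_eq`), and the equation for `W` is invariant under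
changes of time and right translations (`HasMFDerivWithinAt.comp_mul_right`).

*Juxtaposition.* After this, `γ₁` and `γ₂` can be placed side by side into two boxes that are
disjoint in the coordinate `0`, with time intervals chosen at will (`juxtapose`). If the time
interval of `γ₁` precedes that of `γ₂`, then at every time at most one of them moves while the other
one is a constant `n`-loop, which affects neither transported frames nor the loop connection. Hence
the holonomy is `g₂ * g₁`; with the opposite order of the time intervals it is `g₁ * g₂`
(`isHolonomy_mul`).

*Exchange.* The two juxtapositions differ by a reparametrization: a shear of the cube that moves
time by a Möbius transformation of `[0, 2π]`, upwards on one box, downwards on the other one, and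
not at all on the boundary (`shear`, `juxtapose_comp_shear`). Since the Möbius transformations form
a one-parameter group, the shear has an explicit smooth inverse and is smoothly isotopic to the
identity. So `r`-flatness gives `g₁ * g₂ = g₂ * g₁`.
-/

namespace LoopHolonomy

local notation "ℓ" => (2 * Real.pi)

/-! ### The cube and profiles -/

theorem two_pi_pos : 0 < ℓ := by positivity

theorem mem_cube {n : ℕ} {σ : Fin n → ℝ} : σ ∈ cube n ↔ ∀ i, σ i ∈ Icc 0 ℓ := by
  simp only [cube, mem_Icc, Pi.le_def, Pi.zero_apply, forall_and]

theorem uniqueDiffOn_Icc_two_pi : UniqueDiffOn ℝ (Icc 0 ℓ) := uniqueDiffOn_Icc two_pi_pos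

theorem cube_eq_pi (n : ℕ) : cube n = univ.pi fun _ : Fin n => Icc 0 ℓ := by
  ext σ; simp only [mem_cube, mem_univ_pi]

theorem uniqueDiffOn_cube (n : ℕ) : UniqueDiffOn ℝ (cube n) := by
  rw [cube_eq_pi]
  exact UniqueDiffOn.univ_pi fun _ => uniqueDiffOn_Icc_two_pi

theorem snoc_mem_cube {n : ℕ} {σ : Fin n → ℝ} {τ : ℝ} :
    (Fin.snoc σ τ : Fin (n + 1) → ℝ) ∈ cube (n + 1) ↔ σ ∈ cube n ∧ τ ∈ Icc 0 ℓ := by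
  simp only [mem_cube, Fin.forall_fin_succ', Fin.snoc_castSucc, Fin.snoc_last]

theorem update_mem_cube {n : ℕ} {σ : Fin n → ℝ} (hσ : σ ∈ cube n) (i : Fin n) {s : ℝ}
    (hs : s ∈ Icc 0 ℓ) : Function.update σ i s ∈ cube n := by
  rw [mem_cube] at *
  intro j
  by_cases h : j = i
  · subst h; simpa using hs
  · simpa [h] using hσ j

/-- A profile is a smooth monotone reparametrization of `[0, 2π]`, defined on all of `ℝ`, that is
injective where its value is not an end point. It may be constant near the end points, so that it
is not a diffeomorphism. -/
structure IsProfile (φ : ℝ → ℝ) : Prop where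
  contDiff : ContDiff ℝ ∞ φ
  monotone : Monotone φ
  mem_Icc : ∀ x, φ x ∈ Icc 0 ℓ
  map_zero : φ 0 = 0
  map_two_pi : φ ℓ = ℓ
  injOn : InjOn φ (φ ⁻¹' Ioo 0 ℓ)

namespace IsProfile

variable {φ : ℝ → ℝ}

theorem hasDerivAt (h : IsProfile φ) (x : ℝ) : HasDerivAt φ (deriv φ x) x :=
  (h.contDiff.differentiable (by simp)).differentiableAt.hasDerivAt

/-- A profile has extrema at the points where it takes an end point value. -/
theorem deriv_eq_zero (h : IsProfile φ) {x : ℝ} (hx : φ x ∉ Ioo 0 ℓ) : deriv φ x = 0 := by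
  have hm := h.mem_Icc x
  by_cases h0 : φ x = 0
  · exact IsLocalMin.deriv_eq_zero (Filter.Eventually.of_forall fun y => by
      simpa only [h0] using (h.mem_Icc y).1)
  · have h1 : φ x = ℓ := by
      by_contra h1
      exact hx ⟨lt_of_le_of_ne hm.1 (Ne.symm h0), lt_of_le_of_ne hm.2 h1⟩
    exact IsLocalMax.deriv_eq_zero (Filter.Eventually.of_forall fun y => by
      simpa only [h1] using (h.mem_Icc y).2)

theorem mem_Ioo (h : IsProfile φ) {x : ℝ} (hx : φ x ∈ Ioo 0 ℓ) : x ∈ Ioo 0 ℓ := by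
  constructor
  · by_contra! h0
    have := h.monotone h0
    rw [h.map_zero] at this
    exact absurd hx.1 this.not_gt
  · by_contra! h0
    have := h.monotone h0
    rw [h.map_two_pi] at this
    exact absurd hx.2 this.not_gt

end IsProfile

theorem smoothTransition_injOn : InjOn Real.smoothTransition (Ioo 0 1) := by
  refine StrictMonoOn.injOn fun x hx y hy hxy => ?_
  have ha : expNegInvGlue x < expNegInvGlue y := by
    simp only [expNegInvGlue, not_le.2 hx.1, not_le.2 hy.1, if_false]
    exact Real.exp_lt_exp.2 (neg_lt_neg (inv_strictAnti₀ hx.1 hxy))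
  have hb : expNegInvGlue (1 - y) ≤ expNegInvGlue (1 - x) :=
    expNegInvGlue.monotone (by linarith)
  have hb0 : 0 < expNegInvGlue (1 - x) := expNegInvGlue.pos_of_pos (by linarith [hx.2])
  have ha0 : 0 < expNegInvGlue x := expNegInvGlue.pos_of_pos hx.1
  unfold Real.smoothTransition
  rw [div_lt_div_iff₀ (Real.smoothTransition.pos_denom x) (Real.smoothTransition.pos_denom y)]
  nlinarith [mul_lt_mul_of_pos_right ha hb0, mul_le_mul_of_nonneg_left hb ha0.le]

/-- The smooth step that increases from `0` to `1` between `a` and `b`. -/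
noncomputable def smoothStep (a b x : ℝ) : ℝ := Real.smoothTransition ((x - a) / (b - a))

theorem smoothStep_contDiff (a b : ℝ) : ContDiff ℝ ∞ (smoothStep a b) :=
  Real.smoothTransition.contDiff.comp ((contDiff_id.sub contDiff_const).div_const _)

theorem smoothStep_eq_zero {a b x : ℝ} (hab : a < b) (hx : x ≤ a) : smoothStep a b x = 0 :=
  Real.smoothTransition.zero_of_nonpos (div_nonpos_of_nonpos_of_nonneg (by linarith) (by linarith))

theorem smoothStep_eq_one {a b x : ℝ} (hab : a < b) (hx : b ≤ x) : smoothStep a b x = 1 :=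
  Real.smoothTransition.one_of_one_le ((one_le_div (by linarith)).2 (by linarith))

theorem isProfile_smoothStep {a b : ℝ} (ha : 0 ≤ a) (hab : a < b) (hb : b ≤ ℓ) :
    IsProfile fun x => ℓ * smoothStep a b x where
  contDiff := contDiff_const.mul (smoothStep_contDiff a b)
  monotone x y hxy := by
    refine mul_le_mul_of_nonneg_left (Real.smoothTransition.monotone ?_) two_pi_pos.le
    exact div_le_div_of_nonneg_right (by linarith) (by linarith)
  mem_Icc x := ⟨mul_nonneg two_pi_pos.le (Real.smoothTransition.nonneg _),
    mul_le_of_le_one_right two_pi_pos.le (Real.smoothTransition.le_one _)⟩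
  map_zero := by rw [smoothStep_eq_zero hab ha, mul_zero]
  map_two_pi := by rw [smoothStep_eq_one hab hb, mul_one]
  injOn := by
    have key : ∀ x, ℓ * smoothStep a b x ∈ Ioo 0 ℓ → (x - a) / (b - a) ∈ Ioo (0 : ℝ) 1 := by
      intro x hx
      constructor
      · by_contra! h
        simp [smoothStep, Real.smoothTransition.zero_of_nonpos h] at hx
      · by_contra! h
        simp [smoothStep, Real.smoothTransition.one_of_one_le h] at hx
    intro x hx y hy hxy
    have := smoothTransition_injOn (key x hx) (key y hy)
      (mul_left_cancel₀ two_pi_pos.ne' hxy)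
    rw [div_left_inj' (by linarith)] at this
    linarith

theorem piMap_mem_cube {n : ℕ} {φ : Fin n → ℝ → ℝ} (hφ : ∀ i, MapsTo (φ i) (Icc 0 ℓ) (Icc 0 ℓ))
    {σ : Fin n → ℝ} (hσ : σ ∈ cube n) : Pi.map φ σ ∈ cube n :=
  mem_cube.2 fun i => hφ i (mem_cube.1 hσ i)

/-- Change of variables in the cube along a product of profiles. Nothing is assumed about the
integrand: the profiles are injective on the preimage of the open cube, and off this preimage the
Jacobian vanishes. -/
theorem setIntegral_cube_comp_profile {E : Type*} [NormedAddCommGroup E] [NormedSpace ℝ E]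
    {n : ℕ} {φ : Fin n → ℝ → ℝ} (hφ : ∀ i, IsProfile (φ i)) (F : (Fin n → ℝ) → E) :
    ∫ σ in cube n, (∏ i, deriv (φ i) (σ i)) • F (Pi.map φ σ) = ∫ σ in cube n, F σ := by
  set O : Set (Fin n → ℝ) := univ.pi fun _ => Ioo 0 ℓ
  have hO : (O : Set (Fin n → ℝ)) =ᵐ[volume] cube n := Measure.univ_pi_Ioo_ae_eq_Icc
  have hcont : Continuous (Pi.map φ) :=
    continuous_pi fun i => (hφ i).contDiff.continuous.comp (continuous_apply i)
  have hOm : IsOpen O := isOpen_set_pi finite_univ fun _ _ => isOpen_Ioo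
  set S := Pi.map φ ⁻¹' O
  have hS : MeasurableSet S := (hOm.preimage hcont).measurableSet
  have hSc : S ⊆ cube n := fun σ hσ => mem_cube.2 fun i =>
    Ioo_subset_Icc_self ((hφ i).mem_Ioo (hσ i (mem_univ i)))
  have himg : Pi.map φ '' S = O := by
    refine (image_preimage_subset _ _).antisymm fun y hy => ?_
    have : ∀ i, ∃ x, φ i x = y i := fun i => by
      have := intermediate_value_Icc two_pi_pos.le (hφ i).contDiff.continuous.continuousOn
      rw [(hφ i).map_zero, (hφ i).map_two_pi] at this
      obtain ⟨x, -, hx⟩ := this (Ioo_subset_Icc_self (hy i (mem_univ i)))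
      exact ⟨x, hx⟩
    choose x hx using this
    have hxy : Pi.map φ x = y := funext hx
    exact ⟨x, by simpa only [S, mem_preimage, hxy] using hy, hxy⟩
  have hinj : InjOn (Pi.map φ) S := fun x hx y hy hxy => funext fun i =>
    (hφ i).injOn (hx i (mem_univ i)) (hy i (mem_univ i)) (congrFun hxy i)
  have hderiv : ∀ σ ∈ S, HasFDerivWithinAt (Pi.map φ) (ContinuousLinearMap.pi fun i =>
      (ContinuousLinearMap.toSpanSingleton ℝ (deriv (φ i) (σ i))).comp
        (ContinuousLinearMap.proj i)) S σ := fun σ _ =>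
    (hasFDerivAt_pi.2 fun i => ((hφ i).hasDerivAt (σ i)).hasFDerivAt.comp σ
      (hasFDerivAt_apply i σ)).hasFDerivWithinAt
  calc ∫ σ in cube n, (∏ i, deriv (φ i) (σ i)) • F (Pi.map φ σ)
      = ∫ σ in S, (∏ i, deriv (φ i) (σ i)) • F (Pi.map φ σ) := by
        refine setIntegral_eq_of_subset_of_forall_sdiff_eq_zero measurableSet_Icc hSc ?_
        rintro σ ⟨-, hσ⟩
        obtain ⟨i, hi⟩ : ∃ i, φ i (σ i) ∉ Ioo 0 ℓ := by
          by_contra! h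
          exact hσ fun i _ => h i
        rw [Finset.prod_eq_zero (Finset.mem_univ i) ((hφ i).deriv_eq_zero hi), zero_smul]
    _ = ∫ σ in O, F σ := by
        rw [← himg, integral_image_eq_integral_abs_det_fderiv_smul _ hS hderiv hinj]
        refine setIntegral_congr_fun hS fun σ _ => ?_
        rw [ContinuousLinearMap.det_pi, abs_of_nonneg]
        · simp [ContinuousLinearMap.det]
        · refine Finset.prod_nonneg fun i _ => ?_
          simpa [ContinuousLinearMap.det] using (hφ i).monotone.deriv_nonneg
    _ = ∫ σ in cube n, F σ := setIntegral_congr_set hO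

/-! ### Behaviour of the holonomy data under products of profiles -/

theorem piMap_snoc {n : ℕ} (φ : Fin n → ℝ → ℝ) (θ : ℝ → ℝ) (σ : Fin n → ℝ) (τ : ℝ) :
    Pi.map (Fin.snoc φ θ : Fin (n + 1) → ℝ → ℝ) (Fin.snoc σ τ : Fin (n + 1) → ℝ) =
      (Fin.snoc (Pi.map φ σ) (θ τ) : Fin (n + 1) → ℝ) := by
  ext i
  refine Fin.lastCases ?_ (fun j => ?_) i <;> simp [Pi.map]

/-- `γ` runs, for times `t` near `τ`, through the member `γ₁ (·, θ t)` of the family `γ₁`, with the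
space coordinates reparametrized by the profiles `φ`. -/
def FollowsAt {M : Type*} {n : ℕ} (γ γ₁ : (Fin (n + 1) → ℝ) → M) (φ : Fin n → ℝ → ℝ)
    (θ : ℝ → ℝ) (τ : ℝ) : Prop :=
  ∀ᶠ t in nhdsWithin τ (Icc 0 ℓ), ∀ σ ∈ cube n, γ (Fin.snoc σ t) = γ₁ (Fin.snoc (Pi.map φ σ) (θ t))

theorem FollowsAt.slice_eq {M : Type*} {n : ℕ} {γ γ₁ : (Fin (n + 1) → ℝ) → M}
    {φ : Fin n → ℝ → ℝ} {θ : ℝ → ℝ}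
    {τ : ℝ} (h : FollowsAt γ γ₁ φ θ τ) (hτ : τ ∈ Icc 0 ℓ) {σ : Fin n → ℝ} (hσ : σ ∈ cube n) :
    slice γ τ σ = (slice γ₁ (θ τ) ∘ Pi.map φ) σ :=
  h.self_of_nhdsWithin hτ σ hσ

theorem FollowsAt.eventuallyEq {M : Type*} {n : ℕ} {γ γ₁ : (Fin (n + 1) → ℝ) → M}
    {φ : Fin n → ℝ → ℝ}
    {θ : ℝ → ℝ} {τ : ℝ} (h : FollowsAt γ γ₁ φ θ τ) (σ : Fin n → ℝ) :
    γ =ᶠ[nhdsWithin (Fin.snoc σ τ) (cube (n + 1))] γ₁ ∘ Pi.map (Fin.snoc φ θ) := by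
  have hlast : Filter.Tendsto (fun q : Fin (n + 1) → ℝ => q (Fin.last n))
      (nhdsWithin (Fin.snoc σ τ) (cube (n + 1))) (nhdsWithin τ (Icc 0 ℓ)) := by
    have := ((continuous_apply (Fin.last n)).continuousWithinAt
      (s := cube (n + 1)) (x := (Fin.snoc σ τ : Fin (n + 1) → ℝ))).tendsto_nhdsWithin
      (t := Icc 0 ℓ) fun q hq => mem_cube.1 hq (Fin.last n)
    simpa using this
  filter_upwards [hlast.eventually h, self_mem_nhdsWithin] with q hq hqc
  obtain ⟨σ', t, rfl⟩ : ∃ (σ' : Fin n → ℝ) (t : ℝ), q = Fin.snoc σ' t :=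
    ⟨Fin.init q, q (Fin.last n), (Fin.snoc_init_self q).symm⟩
  rw [Function.comp_apply, piMap_snoc]
  simpa using hq σ' (snoc_mem_cube.1 hqc).1

section Reparam

variable {EM : Type*} [NormedAddCommGroup EM] [NormedSpace ℝ EM]
  {EP : Type*} [NormedAddCommGroup EP] [NormedSpace ℝ EP]
  {EG : Type*} [NormedAddCommGroup EG] [NormedSpace ℝ EG]
  {M : Type*} [TopologicalSpace M] [ChartedSpace EM M]
  {P : Type*} [TopologicalSpace P] [ChartedSpace EP P]
  {G : Type*} [TopologicalSpace G] [ChartedSpace EG G] [Group G]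

theorem mfderivWithin_comp_piMap {m : ℕ} {γ : (Fin m → ℝ) → M} {φ : Fin m → ℝ → ℝ}
    {d p : Fin m → ℝ} (hp : p ∈ cube m) (hφ : ∀ i, MapsTo (φ i) (Icc 0 ℓ) (Icc 0 ℓ))
    (hd : ∀ i, HasDerivWithinAt (φ i) (d i) (Icc 0 ℓ) (p i))
    (hγ : MDifferentiableWithinAt 𝓘(ℝ, Fin m → ℝ) 𝓘(ℝ, EM) γ (cube m) (Pi.map φ p)) (i : Fin m) :
    (mfderivWithin 𝓘(ℝ, Fin m → ℝ) 𝓘(ℝ, EM) (γ ∘ Pi.map φ) (cube m) p (Pi.single i (1 : ℝ)) : EM) =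
      d i • (mfderivWithin 𝓘(ℝ, Fin m → ℝ) 𝓘(ℝ, EM) γ (cube m) (Pi.map φ p)
        (Pi.single i (1 : ℝ)) : EM) := by
  have h : HasFDerivWithinAt (Pi.map φ) (ContinuousLinearMap.pi fun i =>
      (ContinuousLinearMap.toSpanSingleton ℝ (d i)).comp (ContinuousLinearMap.proj i))
      (cube m) p := hasFDerivWithinAt_pi.2 fun j =>
    (hd j).hasFDerivWithinAt.comp p (hasFDerivWithinAt_apply j p (cube m))
      fun q hq => mem_cube.1 hq j
  have hs : (ContinuousLinearMap.pi fun i =>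
      (ContinuousLinearMap.toSpanSingleton ℝ (d i)).comp (ContinuousLinearMap.proj i) :
        (Fin m → ℝ) →L[ℝ] (Fin m → ℝ)) (Pi.single i (1 : ℝ)) = d i • Pi.single i (1 : ℝ) := by
    ext j
    by_cases hj : j = i
    · subst hj; simp
    · simp [hj]
  have hc := hγ.hasMFDerivWithinAt.comp p h.hasMFDerivWithinAt fun q hq => piMap_mem_cube hφ hq
  rw [hc.mfderivWithin ((uniqueDiffOn_cube m).uniqueMDiffOn p hp)]
  exact (congrArg (mfderivWithin 𝓘(ℝ, Fin m → ℝ) 𝓘(ℝ, EM) γ (cube m) (Pi.map φ p)) hs).trans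
    (map_smul _ _ _)

theorem mDifferentiableWithinAt_slice {n : ℕ} {γ : (Fin (n + 1) → ℝ) → M}
    (hγ : MDifferentiableOn 𝓘(ℝ, Fin (n + 1) → ℝ) 𝓘(ℝ, EM) γ (cube (n + 1)))
    {τ : ℝ} (hτ : τ ∈ Icc 0 ℓ) {σ : Fin n → ℝ} (hσ : σ ∈ cube n) :
    MDifferentiableWithinAt 𝓘(ℝ, Fin n → ℝ) 𝓘(ℝ, EM) (slice γ τ) (cube n) σ := by
  have h : Differentiable ℝ fun σ : Fin n → ℝ => (Fin.snoc σ τ : Fin (n + 1) → ℝ) := by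
    refine differentiable_pi.2 fun i => Fin.lastCases ?_ (fun j => ?_) i
    · simp
    · simpa using differentiable_apply j
  exact (hγ _ (snoc_mem_cube.2 ⟨hσ, hτ⟩)).comp σ
    (f := fun σ : Fin n → ℝ => (Fin.snoc σ τ : Fin (n + 1) → ℝ))
    (h σ).mdifferentiableAt.mdifferentiableWithinAt fun q hq => snoc_mem_cube.2 ⟨hq, hτ⟩

/-- The loop connection scales with the speed `d` at which `γ` follows `γ₁`: the profiles in space
drop out by the change of variables formula in the cube. -/
theorem FollowsAt.loopConnection_eq [IsManifold 𝓘(ℝ, EM) ∞ M]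
    {𝓟 : PrincipalBundle (EM := EM) (EP := EP) (EG := EG) M P G} {n : ℕ} (B : AdForm 𝓟 (n + 1))
    {γ γ₁ : (Fin (n + 1) → ℝ) → M} {φ : Fin n → ℝ → ℝ} {θ : ℝ → ℝ} {τ d : ℝ}
    (h : FollowsAt γ γ₁ φ θ τ) (hτ : τ ∈ Icc 0 ℓ)
    (hγ₁ : MDifferentiableOn 𝓘(ℝ, Fin (n + 1) → ℝ) 𝓘(ℝ, EM) γ₁ (cube (n + 1)))
    (hφ : ∀ i, IsProfile (φ i)) (hθ : MapsTo θ (Icc 0 ℓ) (Icc 0 ℓ))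
    (hd : HasDerivWithinAt θ d (Icc 0 ℓ) τ) (u : (Fin n → ℝ) → P) :
    loopConnection B (slice γ τ) (u ∘ Pi.map φ) (velocity γ τ) =
      d • loopConnection B (slice γ₁ (θ τ)) u (velocity γ₁ (θ τ)) := by
  have hmaps : ∀ i, MapsTo (φ i) (Icc 0 ℓ) (Icc 0 ℓ) := fun i x _ => (hφ i).mem_Icc x
  have hmaps' : ∀ i, MapsTo ((Fin.snoc φ θ : Fin (n + 1) → ℝ → ℝ) i) (Icc 0 ℓ) (Icc 0 ℓ) := by
    refine fun i => Fin.lastCases ?_ (fun j => ?_) i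
    · simpa using hθ
    · simpa using hmaps j
  unfold loopConnection
  rw [← integral_smul]
  refine Eq.trans ?_ (setIntegral_cube_comp_profile hφ _)
  refine setIntegral_congr_fun measurableSet_Icc fun σ hσ => ?_
  have hspace : ∀ i, (mfderivWithin 𝓘(ℝ, Fin n → ℝ) 𝓘(ℝ, EM) (slice γ τ) (cube n) σ
      (Pi.single i (1 : ℝ)) : EM) = deriv (φ i) (σ i) •
        (mfderivWithin 𝓘(ℝ, Fin n → ℝ) 𝓘(ℝ, EM) (slice γ₁ (θ τ)) (cube n) (Pi.map φ σ)
          (Pi.single i (1 : ℝ)) : EM) := by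
    intro i
    rw [← mfderivWithin_comp_piMap hσ hmaps
      (fun i => ((hφ i).hasDerivAt (σ i)).hasDerivWithinAt)
      (mDifferentiableWithinAt_slice hγ₁ (hθ hτ) (piMap_mem_cube hmaps hσ)) i]
    rw [mfderivWithin_congr_of_mem (fun q hq => h.slice_eq hτ hq) hσ]
    rfl
  have htime : velocity (EM := EM) γ τ σ = d • velocity (EM := EM) γ₁ (θ τ) (Pi.map φ σ) := by
    have hp : (Fin.snoc σ τ : Fin (n + 1) → ℝ) ∈ cube (n + 1) := snoc_mem_cube.2 ⟨hσ, hτ⟩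
    have := mfderivWithin_comp_piMap (γ := γ₁) (φ := Fin.snoc φ θ)
      (d := Fin.snoc (fun i => deriv (φ i) (σ i)) d) hp hmaps'
      (fun i => by
        refine Fin.lastCases ?_ (fun j => ?_) i
        · simpa using hd
        · simpa using ((hφ j).hasDerivAt (σ j)).hasDerivWithinAt)
      (hγ₁ _ (piMap_mem_cube hmaps' hp)) (Fin.last n)
    rw [Fin.snoc_last, piMap_snoc] at this
    refine Eq.trans ?_ this
    exact congrArg (fun L : (Fin (n + 1) → ℝ) →L[ℝ] EM => L (Pi.single (Fin.last n) (1 : ℝ)))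
      ((h.eventuallyEq σ).mfderivWithin_eq_of_mem hp)
  have hcons : (Fin.cons (velocity (EM := EM) γ τ σ) fun i => mfderivWithin 𝓘(ℝ, Fin n → ℝ) 𝓘(ℝ, EM)
      (slice γ τ) (cube n) σ (Pi.single i (1 : ℝ)) : Fin (n + 1) → EM) =
      fun i => (Fin.cons d fun i => deriv (φ i) (σ i) : Fin (n + 1) → ℝ) i •
        (Fin.cons (velocity (EM := EM) γ₁ (θ τ) (Pi.map φ σ)) fun i =>
          mfderivWithin 𝓘(ℝ, Fin n → ℝ) 𝓘(ℝ, EM) (slice γ₁ (θ τ)) (cube n) (Pi.map φ σ)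
            (Pi.single i (1 : ℝ)) : Fin (n + 1) → EM) i := by
    funext i
    refine Fin.cases ?_ (fun j => ?_) i
    · exact htime
    · exact hspace j
  have hB := (B.toFun (u (Pi.map φ σ))).toMultilinearMap.map_smul_univ
    (Fin.cons d fun i => deriv (φ i) (σ i) : Fin (n + 1) → ℝ)
    (Fin.cons (velocity (EM := EM) γ₁ (θ τ) (Pi.map φ σ)) fun i =>
      mfderivWithin 𝓘(ℝ, Fin n → ℝ) 𝓘(ℝ, EM) (slice γ₁ (θ τ)) (cube n) (Pi.map φ σ)
        (Pi.single i (1 : ℝ)) : Fin (n + 1) → EM)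
  refine (congrArg (B.toFun (u (Pi.map φ σ))) hcons).trans (hB.trans ?_)
  rw [Fin.prod_univ_succ, Fin.cons_zero, mul_comm, mul_smul]
  simp only [Fin.cons_succ]
  rfl

theorem rightInvariant_smul (c : ℝ) (ξ : EG) (g : G) :
    rightInvariant (c • ξ) g = c • rightInvariant ξ g := map_smul _ _ _

variable [IsManifold 𝓘(ℝ, EP) ∞ P]
  {𝓟 : PrincipalBundle (EM := EM) (EP := EP) (EG := EG) M P G}

theorem IsHorizontalLift.comp {A : Connection 𝓟} {c : ℝ → M} {u : ℝ → P}
    (h : IsHorizontalLift A c u) {φ : ℝ → ℝ} (hφ : DifferentiableOn ℝ φ (Icc 0 ℓ))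
    (hmaps : MapsTo φ (Icc 0 ℓ) (Icc 0 ℓ)) : IsHorizontalLift A (c ∘ φ) (u ∘ φ) := by
  intro s hs
  obtain ⟨h1, h2, h3⟩ := h (φ s) (hmaps hs)
  have hd := (hφ s hs).hasDerivWithinAt
  have hc := h2.hasMFDerivWithinAt.comp s hd.hasFDerivWithinAt.hasMFDerivWithinAt hmaps
  refine ⟨h1, hc.mdifferentiableWithinAt, ?_⟩
  rw [hc.mfderivWithin (uniqueDiffOn_Icc_two_pi.uniqueMDiffOn s hs)]
  have e : (ContinuousLinearMap.toSpanSingleton ℝ (derivWithin φ (Icc 0 ℓ) s)) (1 : ℝ) =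
      derivWithin φ (Icc 0 ℓ) s • (1 : ℝ) := by simp
  have e' := (congrArg (mfderivWithin 𝓘(ℝ, ℝ) 𝓘(ℝ, EP) u (Icc 0 ℓ) (φ s)) e).trans
    (map_smul _ _ _)
  refine (congrArg (A.form (u (φ s))) e').trans ?_
  rw [map_smul, h3, smul_zero]

/-- Transported frames are compatible with profiles in space: as a profile fixes `0`, the curve
`s ↦ N (φ₀ s, φ₁ σ², …)` starts at the same point as the original one, and horizontality is
preserved by the chain rule, even where the profile is constant. -/
theorem IsTransportedFrame.comp {A : Connection 𝓟} {u₀ : P} {n : ℕ} [NeZero n]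
    {N N' : (Fin n → ℝ) → M} {u : (Fin n → ℝ) → P} (h : IsTransportedFrame A u₀ N u)
    {φ : Fin n → ℝ → ℝ} (hφ : ∀ i, IsProfile (φ i)) (hN : ∀ σ ∈ cube n, N' σ = N (Pi.map φ σ)) :
    IsTransportedFrame A u₀ N' (u ∘ Pi.map φ) := by
  intro σ hσ
  have hmaps : ∀ i, MapsTo (φ i) (Icc 0 ℓ) (Icc 0 ℓ) := fun i x _ => (hφ i).mem_Icc x
  have e : ∀ s, Pi.map φ (Function.update σ 0 s) = Function.update (Pi.map φ σ) 0 (φ 0 s) := by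
    intro s
    ext i
    by_cases hi : i = 0
    · subst hi; simp [Pi.map]
    · simp [Pi.map, hi]
  obtain ⟨h1, h2⟩ := h (Pi.map φ σ) (piMap_mem_cube hmaps hσ)
  refine ⟨by rw [Function.comp_apply, e, (hφ 0).map_zero, h1], ?_⟩
  have h3 := h2.comp ((hφ 0).contDiff.differentiable (by simp)).differentiableOn (hmaps 0)
  intro s hs
  obtain ⟨h4, h5⟩ := h3 s hs
  have e' : (fun s => (u ∘ Pi.map φ) (Function.update σ 0 s)) =
      (fun s => u (Function.update (Pi.map φ σ) 0 s)) ∘ φ 0 := by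
    funext s; simp only [Function.comp_apply, e]
  rw [e']
  refine ⟨h4.trans ?_, h5⟩
  simp only [Function.comp_apply, hN _ (update_mem_cube hσ 0 hs), e]

variable [LieGroup 𝓘(ℝ, EG) ∞ G]

theorem mfderiv_mul_right_rightInvariant (ξ : EG) (w g : G) :
    mfderiv 𝓘(ℝ, EG) 𝓘(ℝ, EG) (fun h : G => h * g) w (rightInvariant ξ w) =
      rightInvariant ξ (w * g) := by
  have hm : ∀ a : G, MDifferentiable 𝓘(ℝ, EG) 𝓘(ℝ, EG) fun h : G => h * a := fun a =>
    (contMDiff_mul_right (I := 𝓘(ℝ, EG)) (n := ∞) (a := a)).mdifferentiable (by simp)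
  have hc := (hm g (1 * w)).hasMFDerivAt.comp (1 : G) (hm w 1).hasMFDerivAt
  have e : (fun h : G => h * g) ∘ (fun h : G => h * w) = fun h => h * (w * g) := by
    funext h; simp [mul_assoc]
  rw [e] at hc
  have := hc.mfderiv
  unfold rightInvariant
  rw [this]
  rw [show (1 : G) * w = w from one_mul w] 
  rfl

/-- Reparametrizing time and translating on the right turns a solution of `W' = ξ W` into a
solution of an equation of the same form. -/
theorem HasMFDerivWithinAt.comp_mul_right {W : ℝ → G} {θ : ℝ → ℝ} {τ d : ℝ} {ξ : EG}
    (hW : HasMFDerivWithinAt 𝓘(ℝ, ℝ) 𝓘(ℝ, EG) W (Icc 0 ℓ) (θ τ)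
      ((1 : ℝ →L[ℝ] ℝ).smulRight (rightInvariant ξ (W (θ τ)))))
    (hθ : MapsTo θ (Icc 0 ℓ) (Icc 0 ℓ)) (hd : HasDerivWithinAt θ d (Icc 0 ℓ) τ) (g : G) :
    HasMFDerivWithinAt 𝓘(ℝ, ℝ) 𝓘(ℝ, EG) (fun t => W (θ t) * g) (Icc 0 ℓ) τ
      ((1 : ℝ →L[ℝ] ℝ).smulRight (rightInvariant (d • ξ) (W (θ τ) * g))) := by
  have hm : MDifferentiable 𝓘(ℝ, EG) 𝓘(ℝ, EG) fun h : G => h * g :=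
    (contMDiff_mul_right (I := 𝓘(ℝ, EG)) (n := ∞) (a := g)).mdifferentiable (by simp)
  have h1 := hW.comp τ hd.hasFDerivWithinAt.hasMFDerivWithinAt hθ
  have h2 := (hm (W (θ τ))).hasMFDerivAt.comp_hasMFDerivWithinAt τ h1
  refine h2.congr_mfderiv ?_
  rw [rightInvariant_smul, ← mfderiv_mul_right_rightInvariant]
  ext
  set L := mfderiv 𝓘(ℝ, EG) 𝓘(ℝ, EG) (fun h : G => h * g) (W (θ τ))
  change L (((1 : ℝ) • d) • rightInvariant ξ (W (θ τ))) =
    (1 : ℝ) • d • L (rightInvariant ξ (W (θ τ)))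
  rw [one_smul, one_smul]
  exact map_smul L d _

end Reparam

/-! ### Concatenation of loops of `n`-loops -/

/-- A differentiable reparametrization of time, not necessarily monotone. -/
structure IsTimeChange (θ : ℝ → ℝ) : Prop where
  differentiableOn : DifferentiableOn ℝ θ (Icc 0 ℓ)
  mapsTo : MapsTo θ (Icc 0 ℓ) (Icc 0 ℓ)
  map_zero : θ 0 = 0
  map_two_pi : θ ℓ = ℓ

theorem IsProfile.isTimeChange {φ : ℝ → ℝ} (h : IsProfile φ) : IsTimeChange φ where
  differentiableOn := (h.contDiff.differentiable (by simp)).differentiableOn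
  mapsTo x _ := h.mem_Icc x
  map_zero := h.map_zero
  map_two_pi := h.map_two_pi

/-- Profiles in the space coordinates: in the coordinate `0` the profile is active between `a` and
`b`, in all others between `2π / 8` and `7 * 2π / 8`. -/
noncomputable def boxProfile (a b : ℝ) {n : ℕ} [NeZero n] (i : Fin n) (x : ℝ) : ℝ :=
  ℓ * if i = 0 then smoothStep a b x else smoothStep (ℓ / 8) (7 * ℓ / 8) x

theorem isProfile_boxProfile {a b : ℝ} (ha : 0 ≤ a) (hab : a < b) (hb : b ≤ ℓ) {n : ℕ} [NeZero n]
    (i : Fin n) : IsProfile (boxProfile a b i) := by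
  have := two_pi_pos
  unfold boxProfile
  split_ifs
  · exact isProfile_smoothStep ha hab hb
  · exact isProfile_smoothStep (by linarith) (by linarith) (by linarith)

/-- The profiles for the left half of the cube. -/
noncomputable def leftProfile {n : ℕ} [NeZero n] : Fin n → ℝ → ℝ := boxProfile (ℓ / 8) (3 * ℓ / 8)

/-- The profiles for the right half of the cube. -/
noncomputable def rightProfile {n : ℕ} [NeZero n] : Fin n → ℝ → ℝ :=
  boxProfile (5 * ℓ / 8) (7 * ℓ / 8)

theorem isProfile_leftProfile {n : ℕ} [NeZero n] (i : Fin n) : IsProfile (leftProfile i) := by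
  have := two_pi_pos
  exact isProfile_boxProfile (by linarith) (by linarith) (by linarith) i

theorem isProfile_rightProfile {n : ℕ} [NeZero n] (i : Fin n) : IsProfile (rightProfile i) := by
  have := two_pi_pos
  exact isProfile_boxProfile (by linarith) (by linarith) (by linarith) i

theorem leftProfile_zero_eq {n : ℕ} [NeZero n] {x : ℝ} (hx : 3 * ℓ / 8 ≤ x) :
    leftProfile (0 : Fin n) x = ℓ := by
  have := two_pi_pos
  simp only [leftProfile, boxProfile, if_true]
  rw [smoothStep_eq_one (by linarith) hx, mul_one]

theorem rightProfile_zero_eq {n : ℕ} [NeZero n] {x : ℝ} (hx : x ≤ 5 * ℓ / 8) :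
    rightProfile (0 : Fin n) x = 0 := by
  have := two_pi_pos
  simp only [rightProfile, boxProfile, if_true]
  rw [smoothStep_eq_zero (by linarith) hx, mul_zero]

/-- `γ₁` and `γ₂` side by side in the cube, with separate reparametrizations of time. For `γ₁`
and `γ₂` in `Ωⁿ⁺¹(M, x₀)` each half is at `x₀` outside the box singled out by its profiles. -/
noncomputable def juxtapose {M : Type*} {n : ℕ} [NeZero n]
    (γ₁ γ₂ : (Fin (n + 1) → ℝ) → M) (θ₁ θ₂ : ℝ → ℝ) :
    (Fin (n + 1) → ℝ) → M := fun p =>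
  if p 0 ≤ ℓ / 2 then γ₁ (Pi.map (Fin.snoc leftProfile θ₁) p)
  else γ₂ (Pi.map (Fin.snoc rightProfile θ₂) p)

theorem snoc_zero {α : Type*} {n : ℕ} [NeZero n] (σ : Fin n → α) (τ : α) :
    (Fin.snoc σ τ : Fin (n + 1) → α) 0 = σ 0 := by
  rw [← Fin.castSucc_zero', Fin.snoc_castSucc (α := fun _ => α)]

theorem piMap_snoc_mem_cube {n : ℕ} {φ : Fin n → ℝ → ℝ} {θ : ℝ → ℝ}
    (hφ : ∀ i, MapsTo (φ i) (Icc 0 ℓ) (Icc 0 ℓ)) (hθ : MapsTo θ (Icc 0 ℓ) (Icc 0 ℓ))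
    {p : Fin (n + 1) → ℝ} (hp : p ∈ cube (n + 1)) :
    Pi.map (Fin.snoc φ θ : Fin (n + 1) → ℝ → ℝ) p ∈ cube (n + 1) := by
  refine piMap_mem_cube (fun i => Fin.lastCases ?_ (fun j => ?_) i) hp
  · simpa using hθ
  · simpa using hφ j

section

variable {EM : Type*} [NormedAddCommGroup EM] [NormedSpace ℝ EM]
  {M : Type*} [TopologicalSpace M] [ChartedSpace EM M]
  {n : ℕ} {x₀ : M} {γ₁ γ₂ : (Fin (n + 1) → ℝ) → M} {θ₁ θ₂ : ℝ → ℝ}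

theorem apply_piMap_eq_of_mem_boundary {γ : (Fin (n + 1) → ℝ) → M} {φ : Fin n → ℝ → ℝ} {θ : ℝ → ℝ}
    (hγ : γ ∈ LoopSpace (EM := EM) x₀ (n + 1)) (hφ : ∀ i, IsProfile (φ i))
    (hθ : MapsTo θ (Icc 0 ℓ) (Icc 0 ℓ)) {p : Fin (n + 1) → ℝ} (hp : p ∈ cube (n + 1))
    (h : (∃ i, φ i (p i.castSucc) = 0 ∨ φ i (p i.castSucc) = ℓ) ∨
      θ (p (Fin.last n)) = 0 ∨ θ (p (Fin.last n)) = ℓ) :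
    γ (Pi.map (Fin.snoc φ θ) p) = x₀ := by
  refine hγ.2 _ ⟨piMap_snoc_mem_cube (fun i x _ => (hφ i).mem_Icc x) hθ hp, ?_⟩
  rcases h with ⟨i, hi⟩ | h
  · exact ⟨i.castSucc, by simpa [Pi.map] using hi⟩
  · exact ⟨Fin.last n, by simpa [Pi.map] using h⟩

theorem contMDiffOn_comp_piMap_snoc {γ : (Fin (n + 1) → ℝ) → M} {φ : Fin n → ℝ → ℝ} {θ : ℝ → ℝ}
    (hγ : γ ∈ LoopSpace (EM := EM) x₀ (n + 1)) (hφ : ∀ i, IsProfile (φ i)) (hθ : IsProfile θ) :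
    ContMDiffOn 𝓘(ℝ, Fin (n + 1) → ℝ) 𝓘(ℝ, EM) ∞ (fun p => γ (Pi.map (Fin.snoc φ θ) p))
      (cube (n + 1)) := by
  have h : ContDiff ℝ ∞ (Pi.map (Fin.snoc φ θ : Fin (n + 1) → ℝ → ℝ)) := by
    refine contDiff_pi.2 fun i => ?_
    refine ContDiff.comp ?_ (contDiff_apply ℝ ℝ i)
    refine Fin.lastCases ?_ (fun j => ?_) i
    · simpa using hθ.contDiff
    · simpa using (hφ j).contDiff
  exact hγ.1.comp h.contMDiff.contMDiffOn fun p hp =>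
    piMap_snoc_mem_cube (fun i x _ => (hφ i).mem_Icc x) (fun x _ => hθ.mem_Icc x) hp

variable [NeZero n]

/-- A juxtaposition agrees with its left member also in the right half of the cube, as long as the
right member is at the base point there. -/
theorem juxtapose_eq_left (hγ₁ : γ₁ ∈ LoopSpace (EM := EM) x₀ (n + 1))
    (hγ₂ : γ₂ ∈ LoopSpace (EM := EM) x₀ (n + 1)) (hθ₁ : MapsTo θ₁ (Icc 0 ℓ) (Icc 0 ℓ))
    (hθ₂ : MapsTo θ₂ (Icc 0 ℓ) (Icc 0 ℓ)) {p : Fin (n + 1) → ℝ} (hp : p ∈ cube (n + 1))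
    (h : p 0 ≤ 5 * ℓ / 8 ∨ θ₂ (p (Fin.last n)) = 0 ∨ θ₂ (p (Fin.last n)) = ℓ) :
    juxtapose γ₁ γ₂ θ₁ θ₂ p = γ₁ (Pi.map (Fin.snoc leftProfile θ₁) p) := by
  have := two_pi_pos
  unfold juxtapose
  split_ifs with h0
  · rfl
  rw [apply_piMap_eq_of_mem_boundary hγ₁ isProfile_leftProfile hθ₁ hp,
    apply_piMap_eq_of_mem_boundary hγ₂ isProfile_rightProfile hθ₂ hp]
  · refine h.imp (fun h => ⟨0, Or.inl ?_⟩) id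
    rw [Fin.castSucc_zero', rightProfile_zero_eq h]
  · refine Or.inl ⟨0, Or.inr ?_⟩
    rw [Fin.castSucc_zero', leftProfile_zero_eq (by linarith)]

theorem juxtapose_eq_right (hγ₁ : γ₁ ∈ LoopSpace (EM := EM) x₀ (n + 1))
    (hγ₂ : γ₂ ∈ LoopSpace (EM := EM) x₀ (n + 1)) (hθ₁ : MapsTo θ₁ (Icc 0 ℓ) (Icc 0 ℓ))
    (hθ₂ : MapsTo θ₂ (Icc 0 ℓ) (Icc 0 ℓ)) {p : Fin (n + 1) → ℝ} (hp : p ∈ cube (n + 1))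
    (h : 3 * ℓ / 8 ≤ p 0 ∨ θ₁ (p (Fin.last n)) = 0 ∨ θ₁ (p (Fin.last n)) = ℓ) :
    juxtapose γ₁ γ₂ θ₁ θ₂ p = γ₂ (Pi.map (Fin.snoc rightProfile θ₂) p) := by
  have := two_pi_pos
  unfold juxtapose
  split_ifs with h0
  · rw [apply_piMap_eq_of_mem_boundary hγ₁ isProfile_leftProfile hθ₁ hp,
      apply_piMap_eq_of_mem_boundary hγ₂ isProfile_rightProfile hθ₂ hp]
    · refine Or.inl ⟨0, Or.inl ?_⟩
      rw [Fin.castSucc_zero', rightProfile_zero_eq (by linarith)]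
    · refine h.imp (fun h => ⟨0, Or.inr ?_⟩) id
      rw [Fin.castSucc_zero', leftProfile_zero_eq h]
  · rfl

/-- The two halves of a juxtaposition fit together smoothly because both loops rest at the base
point while `p 0` is between `3 * 2π / 8` and `5 * 2π / 8`. -/
theorem juxtapose_mem_loopSpace (hγ₁ : γ₁ ∈ LoopSpace (EM := EM) x₀ (n + 1))
    (hγ₂ : γ₂ ∈ LoopSpace (EM := EM) x₀ (n + 1)) (hθ₁ : IsProfile θ₁) (hθ₂ : IsProfile θ₂) :
    juxtapose γ₁ γ₂ θ₁ θ₂ ∈ LoopSpace (EM := EM) x₀ (n + 1) := by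
  have hpi := two_pi_pos
  have hm₁ : MapsTo θ₁ (Icc 0 ℓ) (Icc 0 ℓ) := fun x _ => hθ₁.mem_Icc x
  have hm₂ : MapsTo θ₂ (Icc 0 ℓ) (Icc 0 ℓ) := fun x _ => hθ₂.mem_Icc x
  constructor
  · intro p hp
    by_cases h0 : p 0 < 5 * ℓ / 8
    · refine (contMDiffOn_comp_piMap_snoc hγ₁ isProfile_leftProfile hθ₁ p
        hp).congr_of_eventuallyEq ?_ (juxtapose_eq_left hγ₁ hγ₂ hm₁ hm₂ hp (Or.inl h0.le))
      filter_upwards [self_mem_nhdsWithin, mem_nhdsWithin_of_mem_nhds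
        ((continuous_apply 0).continuousAt.eventually (gt_mem_nhds h0))] with q hq hq0
      exact juxtapose_eq_left hγ₁ hγ₂ hm₁ hm₂ hq (Or.inl hq0.le)
    · have h0' : 3 * ℓ / 8 < p 0 := by linarith
      refine (contMDiffOn_comp_piMap_snoc hγ₂ isProfile_rightProfile hθ₂ p
        hp).congr_of_eventuallyEq ?_ (juxtapose_eq_right hγ₁ hγ₂ hm₁ hm₂ hp (Or.inl h0'.le))
      filter_upwards [self_mem_nhdsWithin, mem_nhdsWithin_of_mem_nhds
        ((continuous_apply 0).continuousAt.eventually (lt_mem_nhds h0'))] with q hq hq0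
      exact juxtapose_eq_right hγ₁ hγ₂ hm₁ hm₂ hq (Or.inl hq0.le)
  · rintro p ⟨hp, i, hi⟩
    have key : ∀ {φ : Fin n → ℝ → ℝ} {θ : ℝ → ℝ}, (∀ i, IsProfile (φ i)) → IsProfile θ →
        (∃ i : Fin n, φ i (p i.castSucc) = 0 ∨ φ i (p i.castSucc) = ℓ) ∨
          θ (p (Fin.last n)) = 0 ∨ θ (p (Fin.last n)) = ℓ := by
      intro φ θ hφ hθ
      revert hi
      refine Fin.lastCases (fun hi => Or.inr ?_) (fun j hi => Or.inl ⟨j, ?_⟩) i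
      · rcases hi with hi | hi <;> simp [hi, hθ.map_zero, hθ.map_two_pi]
      · rcases hi with hi | hi <;> simp [hi, (hφ j).map_zero, (hφ j).map_two_pi]
    unfold juxtapose
    split_ifs
    · exact apply_piMap_eq_of_mem_boundary hγ₁ isProfile_leftProfile hm₁ hp
        (key isProfile_leftProfile hθ₁)
    · exact apply_piMap_eq_of_mem_boundary hγ₂ isProfile_rightProfile hm₂ hp
        (key isProfile_rightProfile hθ₂)

theorem followsAt_left {γ : (Fin (n + 1) → ℝ) → M} (hγ₁ : γ₁ ∈ LoopSpace (EM := EM) x₀ (n + 1))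
    (hγ₂ : γ₂ ∈ LoopSpace (EM := EM) x₀ (n + 1)) (hθ₁ : MapsTo θ₁ (Icc 0 ℓ) (Icc 0 ℓ))
    (hθ₂ : MapsTo θ₂ (Icc 0 ℓ) (Icc 0 ℓ)) (hγ : EqOn γ (juxtapose γ₁ γ₂ θ₁ θ₂) (cube (n + 1)))
    {τ : ℝ} (h : ∀ᶠ t in nhdsWithin τ (Icc 0 ℓ), θ₂ t = 0 ∨ θ₂ t = ℓ) :
    FollowsAt γ γ₁ leftProfile θ₁ τ := by
  filter_upwards [h, self_mem_nhdsWithin] with t ht htI σ hσ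
  have hp := snoc_mem_cube.2 ⟨hσ, htI⟩
  rw [hγ hp, juxtapose_eq_left hγ₁ hγ₂ hθ₁ hθ₂ hp (Or.inr (by simpa using ht)), piMap_snoc]

theorem followsAt_right {γ : (Fin (n + 1) → ℝ) → M} (hγ₁ : γ₁ ∈ LoopSpace (EM := EM) x₀ (n + 1))
    (hγ₂ : γ₂ ∈ LoopSpace (EM := EM) x₀ (n + 1)) (hθ₁ : MapsTo θ₁ (Icc 0 ℓ) (Icc 0 ℓ))
    (hθ₂ : MapsTo θ₂ (Icc 0 ℓ) (Icc 0 ℓ)) (hγ : EqOn γ (juxtapose γ₁ γ₂ θ₁ θ₂) (cube (n + 1)))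
    {τ : ℝ} (h : ∀ᶠ t in nhdsWithin τ (Icc 0 ℓ), θ₁ t = 0 ∨ θ₁ t = ℓ) :
    FollowsAt γ γ₂ rightProfile θ₂ τ := by
  filter_upwards [h, self_mem_nhdsWithin] with t ht htI σ hσ
  have hp := snoc_mem_cube.2 ⟨hσ, htI⟩
  rw [hγ hp, juxtapose_eq_right hγ₁ hγ₂ hθ₁ hθ₂ hp (Or.inr (by simpa using ht)), piMap_snoc]

end

section Holonomy

variable {EM : Type*} [NormedAddCommGroup EM] [NormedSpace ℝ EM]
  {EP : Type*} [NormedAddCommGroup EP] [NormedSpace ℝ EP]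
  {EG : Type*} [NormedAddCommGroup EG] [NormedSpace ℝ EG]
  {M : Type*} [TopologicalSpace M] [ChartedSpace EM M] [IsManifold 𝓘(ℝ, EM) ∞ M]
  {P : Type*} [TopologicalSpace P] [ChartedSpace EP P] [IsManifold 𝓘(ℝ, EP) ∞ P]
  {G : Type*} [TopologicalSpace G] [ChartedSpace EG G] [Group G] [LieGroup 𝓘(ℝ, EG) ∞ G]
  {𝓟 : PrincipalBundle (EM := EM) (EP := EP) (EG := EG) M P G}

/-- If `γ` follows first `γ₁` and then `γ₂`, then its holonomy is the product of theirs. The frames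
and the solution `W` for `γ` are those for `γ₁` and `γ₂`, composed with the reparametrizations, so
that neither existence nor uniqueness of parallel transport enters. -/
theorem isHolonomy_mul {A : Connection 𝓟} {n : ℕ} [NeZero n] {B : AdForm 𝓟 (n + 1)} {u₀ : P}
    {γ γ₁ γ₂ : (Fin (n + 1) → ℝ) → M} {φ₁ φ₂ : Fin n → ℝ → ℝ} {θ₁ θ₂ : ℝ → ℝ} {g₁ g₂ : G}
    (hγ₁ : MDifferentiableOn 𝓘(ℝ, Fin (n + 1) → ℝ) 𝓘(ℝ, EM) γ₁ (cube (n + 1)))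
    (hγ₂ : MDifferentiableOn 𝓘(ℝ, Fin (n + 1) → ℝ) 𝓘(ℝ, EM) γ₂ (cube (n + 1)))
    (hφ₁ : ∀ i, IsProfile (φ₁ i)) (hφ₂ : ∀ i, IsProfile (φ₂ i))
    (hθ₁ : IsTimeChange θ₁) (hθ₂ : IsTimeChange θ₂)
    (h : ∀ τ ∈ Icc 0 ℓ,
      (FollowsAt γ γ₁ φ₁ θ₁ τ ∧ ∀ᶠ t in nhdsWithin τ (Icc 0 ℓ), θ₂ t = 0) ∨
      (FollowsAt γ γ₂ φ₂ θ₂ τ ∧ ∀ᶠ t in nhdsWithin τ (Icc 0 ℓ), θ₁ t = ℓ))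
    (hg₁ : IsHolonomy A B u₀ γ₁ g₁) (hg₂ : IsHolonomy A B u₀ γ₂ g₂) :
    IsHolonomy A B u₀ γ (g₂ * g₁) := by
  classical
  obtain ⟨u₁, W₁, hu₁, hW₁0, hW₁, hW₁e⟩ := hg₁
  obtain ⟨u₂, W₂, hu₂, hW₂0, hW₂, hW₂e⟩ := hg₂
  -- Near every time one of the two factors of `W` is constant.
  set W : ℝ → G := fun t => W₂ (θ₂ t) * W₁ (θ₁ t)
  have key : ∀ τ ∈ Icc 0 ℓ, ∃ u : (Fin n → ℝ) → P,
      IsTransportedFrame A u₀ (slice γ τ) u ∧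
      HasMFDerivWithinAt 𝓘(ℝ, ℝ) 𝓘(ℝ, EG) W (Icc 0 ℓ) τ ((1 : ℝ →L[ℝ] ℝ).smulRight
        (rightInvariant (-loopConnection B (slice γ τ) u (velocity γ τ)) (W τ))) := by
    intro τ hτ
    rcases h τ hτ with ⟨hf, hc⟩ | ⟨hf, hc⟩
    · refine ⟨u₁ (θ₁ τ) ∘ Pi.map φ₁, (hu₁ _ (hθ₁.mapsTo hτ)).comp hφ₁ fun σ hσ => hf.slice_eq hτ hσ,
        ?_⟩
      have hd := (hθ₁.differentiableOn τ hτ).hasDerivWithinAt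
      have hev : W =ᶠ[nhdsWithin τ (Icc 0 ℓ)] fun t => W₁ (θ₁ t) * 1 := by
        filter_upwards [hc] with t ht
        simp only [W, ht, hW₂0, one_mul, mul_one]
      have := (HasMFDerivWithinAt.comp_mul_right (hW₁ _ (hθ₁.mapsTo hτ)) hθ₁.mapsTo hd
        1).congr_of_eventuallyEq hev (hev.self_of_nhdsWithin hτ)
      rw [hf.loopConnection_eq B hτ hγ₁ hφ₁ hθ₁.mapsTo hd, ← smul_neg,
        hev.self_of_nhdsWithin hτ]
      exact this
    · refine ⟨u₂ (θ₂ τ) ∘ Pi.map φ₂, (hu₂ _ (hθ₂.mapsTo hτ)).comp hφ₂ fun σ hσ => hf.slice_eq hτ hσ,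
        ?_⟩
      have hd := (hθ₂.differentiableOn τ hτ).hasDerivWithinAt
      have hev : W =ᶠ[nhdsWithin τ (Icc 0 ℓ)] fun t => W₂ (θ₂ t) * g₁ := by
        filter_upwards [hc] with t ht
        simp only [W, ht, hW₁e]
      have := (HasMFDerivWithinAt.comp_mul_right (hW₂ _ (hθ₂.mapsTo hτ)) hθ₂.mapsTo hd
        g₁).congr_of_eventuallyEq hev (hev.self_of_nhdsWithin hτ)
      rw [hf.loopConnection_eq B hτ hγ₂ hφ₂ hθ₂.mapsTo hd, ← smul_neg,
        hev.self_of_nhdsWithin hτ]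
      exact this
  have : Nonempty P := ⟨u₀⟩
  choose! u hu hW using key
  refine ⟨u, W, hu, ?_, hW, ?_⟩
  · simp only [W, hθ₁.map_zero, hθ₂.map_zero, hW₁0, hW₂0, one_mul]
  · simp only [W, hθ₁.map_two_pi, hθ₂.map_two_pi, hW₁e, hW₂e]

/-- The holonomy of a juxtaposition in which the left member runs first. -/
theorem isHolonomy_juxtapose {A : Connection 𝓟} {n : ℕ} [NeZero n] {B : AdForm 𝓟 (n + 1)} {u₀ : P}
    {γ γ₁ γ₂ : (Fin (n + 1) → ℝ) → M} {θ₁ θ₂ : ℝ → ℝ} {g₁ g₂ : G} {x₀ : M}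
    (hγ₁ : γ₁ ∈ LoopSpace (EM := EM) x₀ (n + 1)) (hγ₂ : γ₂ ∈ LoopSpace (EM := EM) x₀ (n + 1))
    (hθ₁ : IsTimeChange θ₁) (hθ₂ : IsTimeChange θ₂)
    (hγ : EqOn γ (juxtapose γ₁ γ₂ θ₁ θ₂) (cube (n + 1)))
    (h : ∀ τ ∈ Icc 0 ℓ, (∀ᶠ t in nhdsWithin τ (Icc 0 ℓ), θ₂ t = 0) ∨
      ∀ᶠ t in nhdsWithin τ (Icc 0 ℓ), θ₁ t = ℓ)
    (hg₁ : IsHolonomy A B u₀ γ₁ g₁) (hg₂ : IsHolonomy A B u₀ γ₂ g₂) :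
    IsHolonomy A B u₀ γ (g₂ * g₁) :=
  isHolonomy_mul (hγ₁.1.mdifferentiableOn (by simp)) (hγ₂.1.mdifferentiableOn (by simp))
    isProfile_leftProfile isProfile_rightProfile hθ₁ hθ₂ (fun τ hτ => (h τ hτ).imp
      (fun h => ⟨followsAt_left hγ₁ hγ₂ hθ₁.mapsTo hθ₂.mapsTo hγ (h.mono fun _ => Or.inl), h⟩)
      (fun h => ⟨followsAt_right hγ₁ hγ₂ hθ₁.mapsTo hθ₂.mapsTo hγ (h.mono fun _ => Or.inr), h⟩))
    hg₁ hg₂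

/-- The holonomy of a juxtaposition in which the right member runs first. -/
theorem isHolonomy_juxtapose' {A : Connection 𝓟} {n : ℕ} [NeZero n] {B : AdForm 𝓟 (n + 1)} {u₀ : P}
    {γ γ₁ γ₂ : (Fin (n + 1) → ℝ) → M} {θ₁ θ₂ : ℝ → ℝ} {g₁ g₂ : G} {x₀ : M}
    (hγ₁ : γ₁ ∈ LoopSpace (EM := EM) x₀ (n + 1)) (hγ₂ : γ₂ ∈ LoopSpace (EM := EM) x₀ (n + 1))
    (hθ₁ : IsTimeChange θ₁) (hθ₂ : IsTimeChange θ₂)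
    (hγ : EqOn γ (juxtapose γ₁ γ₂ θ₁ θ₂) (cube (n + 1)))
    (h : ∀ τ ∈ Icc 0 ℓ, (∀ᶠ t in nhdsWithin τ (Icc 0 ℓ), θ₁ t = 0) ∨
      ∀ᶠ t in nhdsWithin τ (Icc 0 ℓ), θ₂ t = ℓ)
    (hg₁ : IsHolonomy A B u₀ γ₁ g₁) (hg₂ : IsHolonomy A B u₀ γ₂ g₂) :
    IsHolonomy A B u₀ γ (g₁ * g₂) :=
  isHolonomy_mul (hγ₂.1.mdifferentiableOn (by simp)) (hγ₁.1.mdifferentiableOn (by simp))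
    isProfile_rightProfile isProfile_leftProfile hθ₂ hθ₁ (fun τ hτ => (h τ hτ).imp
      (fun h => ⟨followsAt_right hγ₁ hγ₂ hθ₁.mapsTo hθ₂.mapsTo hγ (h.mono fun _ => Or.inl), h⟩)
      (fun h => ⟨followsAt_left hγ₁ hγ₂ hθ₁.mapsTo hθ₂.mapsTo hγ (h.mono fun _ => Or.inr), h⟩))
    hg₂ hg₁

end Holonomy

/-! ### A reparametrization that exchanges the order of two loops -/

/-- The one-parameter group of Möbius transformations of `[0, 2π]` that fix both end points; in
the coordinate `y / (2π - y)` it is multiplication by `exp s`. -/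
noncomputable def moebiusFlow (s y : ℝ) : ℝ := ℓ * Real.exp s * y / (ℓ + (Real.exp s - 1) * y)

theorem moebiusFlow_denom_pos (s : ℝ) {y : ℝ} (hy : y ∈ Icc 0 ℓ) :
    0 < ℓ + (Real.exp s - 1) * y := by
  have he := Real.exp_pos s
  have := two_pi_pos
  rcases hy.2.eq_or_lt with h | h
  · rw [h]; nlinarith
  · nlinarith [mul_nonneg he.le hy.1]

theorem moebiusFlow_mapsTo (s : ℝ) : MapsTo (moebiusFlow s) (Icc 0 ℓ) (Icc 0 ℓ) := by
  intro y hy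
  have hd := moebiusFlow_denom_pos s hy
  have := two_pi_pos
  refine ⟨div_nonneg (mul_nonneg (by positivity) hy.1) hd.le, (div_le_iff₀ hd).2 ?_⟩
  nlinarith [mul_nonneg this.le (sub_nonneg.2 hy.2)]

theorem moebiusFlow_neg_self (s : ℝ) {y : ℝ} (hy : y ∈ Icc 0 ℓ) :
    moebiusFlow (-s) (moebiusFlow s y) = y := by
  have hd := (moebiusFlow_denom_pos s hy).ne'
  have hd' := (moebiusFlow_denom_pos (-s) (moebiusFlow_mapsTo s hy)).ne'
  have he := (Real.exp_pos s).ne'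
  unfold moebiusFlow at hd' ⊢
  rw [div_eq_iff hd', Real.exp_neg]
  generalize hD : ℓ + (Real.exp s - 1) * y = D at hd ⊢
  field_simp
  rw [← hD]
  ring

theorem moebiusFlow_zero (y : ℝ) : moebiusFlow 0 y = y := by
  simp [moebiusFlow, mul_div_cancel_left₀ y two_pi_pos.ne']

theorem moebiusFlow_apply_zero (s : ℝ) : moebiusFlow s 0 = 0 := by simp [moebiusFlow]

theorem moebiusFlow_apply_two_pi (s : ℝ) : moebiusFlow s ℓ = ℓ := by
  have hd := (moebiusFlow_denom_pos s (right_mem_Icc.2 two_pi_pos.le)).ne'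
  rw [moebiusFlow, div_eq_iff hd]
  ring

theorem moebiusFlow_contDiffOn :
    ContDiffOn ℝ ∞ (fun q : ℝ × ℝ => moebiusFlow q.1 q.2) (univ ×ˢ Icc 0 ℓ) := by
  have he : ContDiff ℝ ∞ fun q : ℝ × ℝ => Real.exp q.1 := Real.contDiff_exp.comp contDiff_fst
  refine ContDiffOn.div ?_ ?_ fun q hq => (moebiusFlow_denom_pos q.1 hq.2).ne'
  · exact ((contDiff_const.mul he).mul contDiff_snd).contDiffOn
  · exact (contDiff_const.add ((he.sub contDiff_const).mul contDiff_snd)).contDiffOn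

theorem IsProfile.isTimeChange_comp_moebiusFlow {θ : ℝ → ℝ} (h : IsProfile θ) (s : ℝ) :
    IsTimeChange (θ ∘ moebiusFlow s) where
  differentiableOn := by
    refine (h.contDiff.differentiable (by simp)).comp_differentiableOn ?_
    exact (moebiusFlow_contDiffOn.comp (g := fun q : ℝ × ℝ => moebiusFlow q.1 q.2)
      (contDiff_const.prodMk contDiff_id).contDiffOn
      (f := fun y => (s, y)) fun y hy => ⟨mem_univ _, hy⟩).differentiableOn (by simp)
  mapsTo x _ := h.mem_Icc _
  map_zero := by rw [Function.comp_apply, moebiusFlow_apply_zero, h.map_zero]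
  map_two_pi := by rw [Function.comp_apply, moebiusFlow_apply_two_pi, h.map_two_pi]

/-- The shear of the cube that moves time along the Möbius flow, by an amount `a σ` that depends on
the space coordinates. -/
noncomputable def shear {n : ℕ} (a : (Fin n → ℝ) → ℝ) (p : Fin (n + 1) → ℝ) : Fin (n + 1) → ℝ :=
  Fin.snoc (Fin.init p) (moebiusFlow (a (Fin.init p)) (p (Fin.last n)))

theorem shear_snoc {n : ℕ} (a : (Fin n → ℝ) → ℝ) (σ : Fin n → ℝ) (τ : ℝ) :
    shear a (Fin.snoc σ τ : Fin (n + 1) → ℝ) = Fin.snoc σ (moebiusFlow (a σ) τ) := by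
  simp [shear]

theorem exists_snoc_mem_cube {n : ℕ} {p : Fin (n + 1) → ℝ} (hp : p ∈ cube (n + 1)) :
    ∃ σ ∈ cube n, ∃ τ ∈ Icc 0 ℓ, p = Fin.snoc σ τ := by
  have h := Fin.snoc_init_self p
  rw [← h, snoc_mem_cube] at hp
  exact ⟨_, hp.1, _, hp.2, h.symm⟩

theorem shear_mapsTo {n : ℕ} (a : (Fin n → ℝ) → ℝ) :
    MapsTo (shear a) (cube (n + 1)) (cube (n + 1)) := by
  intro p hp
  obtain ⟨σ, hσ, τ, hτ, rfl⟩ := exists_snoc_mem_cube hp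
  rw [shear_snoc]
  exact snoc_mem_cube.2 ⟨hσ, moebiusFlow_mapsTo _ hτ⟩

theorem shear_neg_shear {n : ℕ} (a : (Fin n → ℝ) → ℝ) {p : Fin (n + 1) → ℝ}
    (hp : p ∈ cube (n + 1)) : shear (-a) (shear a p) = p := by
  obtain ⟨σ, hσ, τ, hτ, rfl⟩ := exists_snoc_mem_cube hp
  rw [shear_snoc, shear_snoc, Pi.neg_apply, moebiusFlow_neg_self _ hτ]

theorem shear_contDiffOn {n : ℕ} {a : (Fin n → ℝ) → ℝ} (ha : ContDiff ℝ ∞ a) :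
    ContDiffOn ℝ ∞ (fun q : ℝ × (Fin (n + 1) → ℝ) => shear (q.1 • a) q.2)
      (univ ×ˢ cube (n + 1)) := by
  refine contDiffOn_pi.2 fun i => ?_
  refine Fin.lastCases ?_ (fun j => ?_) i
  · simp only [shear, Fin.snoc_last]
    have hinit : ContDiff ℝ ∞ fun q : ℝ × (Fin (n + 1) → ℝ) => (Fin.init q.2 : Fin n → ℝ) :=
      contDiff_pi.2 fun i => (contDiff_apply ℝ ℝ i.castSucc).comp contDiff_snd
    refine moebiusFlow_contDiffOn.comp (g := fun q : ℝ × ℝ => moebiusFlow q.1 q.2)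
      (f := fun q : ℝ × (Fin (n + 1) → ℝ) => ((q.1 • a) (Fin.init q.2), q.2 (Fin.last n)))
      (ContDiff.contDiffOn ?_) fun q hq => ⟨mem_univ _, mem_cube.1 hq.2 _⟩
    exact (contDiff_fst.mul (ha.comp hinit)).prodMk
      ((contDiff_apply ℝ ℝ (Fin.last n)).comp contDiff_snd)
  · simp only [shear, Fin.snoc_castSucc, Fin.init]
    exact ((contDiff_apply ℝ ℝ j.castSucc).comp contDiff_snd).contDiffOn

theorem isCubeDiffeo_shear {n : ℕ} {a : (Fin n → ℝ) → ℝ} (ha : ContDiff ℝ ∞ a)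
    (ha0 : ∀ σ ∈ cubeBoundary n, a σ = 0) : IsCubeDiffeo (shear a) := by
  have hsm : ∀ {b : (Fin n → ℝ) → ℝ}, ContDiff ℝ ∞ b →
      ContDiffOn ℝ ∞ (shear b) (cube (n + 1)) := by
    intro b hb
    have := (shear_contDiffOn hb).comp
      (f := fun p : Fin (n + 1) → ℝ => ((1 : ℝ), p)) (contDiff_const.prodMk contDiff_id).contDiffOn
      fun p hp => ⟨mem_univ _, hp⟩
    simpa only [Function.comp_def, one_smul] using this
  refine ⟨hsm ha, shear_mapsTo a, ?_, shear (-a), hsm ha.neg, shear_mapsTo _,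
    fun p hp => shear_neg_shear a hp, fun p hp => ?_⟩
  · rintro p ⟨hp, i, hi⟩
    obtain ⟨σ, hσ, τ, hτ, rfl⟩ := exists_snoc_mem_cube hp
    rw [shear_snoc]
    congr 1
    revert hi
    refine Fin.lastCases (fun hi => ?_) (fun j hi => ?_) i
    · rw [Fin.snoc_last] at hi
      rcases hi with rfl | rfl
      · exact moebiusFlow_apply_zero _
      · exact moebiusFlow_apply_two_pi _
    · rw [Fin.snoc_castSucc] at hi
      rw [ha0 σ ⟨hσ, j, hi⟩, moebiusFlow_zero]
  · simpa using shear_neg_shear (-a) hp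

theorem isReparametrization_shear {n : ℕ} {a : (Fin n → ℝ) → ℝ} (ha : ContDiff ℝ ∞ a)
    (ha0 : ∀ σ ∈ cubeBoundary n, a σ = 0) : IsReparametrization (shear a) := by
  refine ⟨fun t => shear (t • a), (shear_contDiffOn ha).mono (prod_mono (subset_univ _) subset_rfl),
    fun t _ => isCubeDiffeo_shear (contDiff_const.mul ha) fun σ hσ => ?_, fun p hp => ?_,
    fun p _ => by simp only [one_smul]⟩
  · simp [ha0 σ hσ]
  · obtain ⟨σ, hσ, τ, hτ, rfl⟩ := exists_snoc_mem_cube hp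
    simp [shear_snoc, moebiusFlow_zero]

/-- The amount by which the exchanging shear moves time: `-log 16` on the box in the left half of
the cube, `log 16` on the box in the right half, and zero on the boundary. -/
noncomputable def exchangeAmount {n : ℕ} [NeZero n] (σ : Fin n → ℝ) : ℝ :=
  Real.log 16 * (2 * smoothStep (3 * ℓ / 8) (5 * ℓ / 8) (σ 0) - 1) *
    ∏ i, smoothStep 0 (ℓ / 8) (σ i) * (1 - smoothStep (7 * ℓ / 8) ℓ (σ i))

theorem exchangeAmount_contDiff {n : ℕ} [NeZero n] :
    ContDiff ℝ ∞ (exchangeAmount : (Fin n → ℝ) → ℝ) := by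
  have h : ∀ (a b : ℝ) (i : Fin n), ContDiff ℝ ∞ fun σ : Fin n → ℝ => smoothStep a b (σ i) :=
    fun a b i => (smoothStep_contDiff a b).comp (contDiff_apply ℝ ℝ i)
  exact (contDiff_const.mul ((contDiff_const.mul (h _ _ 0)).sub contDiff_const)).mul
    (contDiff_prod fun i _ => (h _ _ i).mul (contDiff_const.sub (h _ _ i)))

theorem exchangeAmount_eq_zero {n : ℕ} [NeZero n] {σ : Fin n → ℝ} (hσ : σ ∈ cubeBoundary n) :
    exchangeAmount σ = 0 := by
  have := two_pi_pos
  obtain ⟨-, i, hi⟩ := hσ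
  refine mul_eq_zero_of_right _ (Finset.prod_eq_zero (Finset.mem_univ i) ?_)
  rcases hi with hi | hi
  · rw [hi, smoothStep_eq_zero (by linarith) le_rfl, zero_mul]
  · rw [hi, smoothStep_eq_one (b := ℓ) (by linarith) le_rfl, sub_self, mul_zero]

theorem mem_Icc_of_smoothStep_mem_Ioo {a b x : ℝ} (hab : a < b)
    (h : ℓ * smoothStep a b x ∈ Ioo 0 ℓ) : x ∈ Icc a b := by
  constructor
  · by_contra! hx
    simp [smoothStep_eq_zero hab hx.le] at h
  · by_contra! hx
    simp [smoothStep_eq_one hab hx.le] at h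

theorem mem_Icc_of_boxProfile {a b : ℝ} (ha : ℓ / 8 ≤ a) (hab : a < b) (hb : b ≤ 7 * ℓ / 8)
    {n : ℕ} [NeZero n] {σ : Fin n → ℝ} (h : ∀ i, boxProfile a b i (σ i) ∈ Ioo 0 ℓ) :
    σ 0 ∈ Icc a b ∧ ∀ i, σ i ∈ Icc (ℓ / 8) (7 * ℓ / 8) := by
  have := two_pi_pos
  have h0 : σ 0 ∈ Icc a b := mem_Icc_of_smoothStep_mem_Ioo hab (by simpa [boxProfile] using h 0)
  refine ⟨h0, fun i => ?_⟩
  by_cases hi : i = 0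
  · subst hi
    exact ⟨ha.trans h0.1, h0.2.trans hb⟩
  · exact mem_Icc_of_smoothStep_mem_Ioo (by linarith) (by simpa [boxProfile, hi] using h i)

theorem exchangeAmount_eq {n : ℕ} [NeZero n] {σ : Fin n → ℝ}
    (h : ∀ i, σ i ∈ Icc (ℓ / 8) (7 * ℓ / 8)) :
    exchangeAmount σ = Real.log 16 * (2 * smoothStep (3 * ℓ / 8) (5 * ℓ / 8) (σ 0) - 1) := by
  have := two_pi_pos
  rw [exchangeAmount, Finset.prod_eq_one, mul_one]
  intro i _
  rw [smoothStep_eq_one (by linarith) (h i).1, smoothStep_eq_zero (by linarith) (h i).2]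
  norm_num

theorem exchangeAmount_left {n : ℕ} [NeZero n] {σ : Fin n → ℝ}
    (h : ∀ i, leftProfile i (σ i) ∈ Ioo 0 ℓ) : exchangeAmount σ = -Real.log 16 := by
  have := two_pi_pos
  obtain ⟨h0, h⟩ := mem_Icc_of_boxProfile (by linarith) (by linarith) (by linarith) h
  rw [exchangeAmount_eq h, smoothStep_eq_zero (by linarith) h0.2]
  ring

theorem exchangeAmount_right {n : ℕ} [NeZero n] {σ : Fin n → ℝ}
    (h : ∀ i, rightProfile i (σ i) ∈ Ioo 0 ℓ) : exchangeAmount σ = Real.log 16 := by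
  have := two_pi_pos
  obtain ⟨h0, h⟩ := mem_Icc_of_boxProfile (by linarith) (by linarith) (by linarith) h
  rw [exchangeAmount_eq h, smoothStep_eq_one (by linarith) h0.1]
  ring

/-- Composing with the exchanging shear only changes the time changes of the two loops, since its
amount is constant on each of the boxes outside of which they rest at `x₀`. -/
theorem juxtapose_comp_shear {EM : Type*} [NormedAddCommGroup EM] [NormedSpace ℝ EM]
    {M : Type*} [TopologicalSpace M] [ChartedSpace EM M] {n : ℕ} [NeZero n] {x₀ : M}
    {γ₁ γ₂ : (Fin (n + 1) → ℝ) → M} {θ₁ θ₂ : ℝ → ℝ}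
    (hγ₁ : γ₁ ∈ LoopSpace (EM := EM) x₀ (n + 1)) (hγ₂ : γ₂ ∈ LoopSpace (EM := EM) x₀ (n + 1))
    (hθ₁ : IsProfile θ₁) (hθ₂ : IsProfile θ₂) :
    EqOn (juxtapose γ₁ γ₂ θ₁ θ₂ ∘ shear exchangeAmount)
      (juxtapose γ₁ γ₂ (θ₁ ∘ moebiusFlow (-Real.log 16)) (θ₂ ∘ moebiusFlow (Real.log 16)))
      (cube (n + 1)) := by
  -- Off the box in which a loop is placed, it takes the value `x₀` for every time change.
  have key : ∀ {γ : (Fin (n + 1) → ℝ) → M} {φ : Fin n → ℝ → ℝ} {θ : ℝ → ℝ} {c : ℝ} {σ : Fin n → ℝ}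
      {τ : ℝ}, γ ∈ LoopSpace (EM := EM) x₀ (n + 1) → (∀ i, IsProfile (φ i)) → IsProfile θ →
      ((∀ i, φ i (σ i) ∈ Ioo 0 ℓ) → exchangeAmount σ = c) → σ ∈ cube n → τ ∈ Icc 0 ℓ →
      γ (Pi.map (Fin.snoc φ θ) (Fin.snoc σ (moebiusFlow (exchangeAmount σ) τ) : Fin (n + 1) → ℝ)) =
        γ (Pi.map (Fin.snoc φ (θ ∘ moebiusFlow c)) (Fin.snoc σ τ : Fin (n + 1) → ℝ)) := by
    intro γ φ θ c σ τ hγ hφ hθ hc hσ hτ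
    by_cases h : ∀ i, φ i (σ i) ∈ Ioo 0 ℓ
    · rw [piMap_snoc, piMap_snoc, hc h, Function.comp_apply]
    · push Not at h
      obtain ⟨i, hi⟩ := h
      have hi' : φ i (σ i) = 0 ∨ φ i (σ i) = ℓ := by
        have hm := (hφ i).mem_Icc (σ i)
        by_contra! h'
        exact hi ⟨lt_of_le_of_ne hm.1 h'.1.symm, lt_of_le_of_ne hm.2 h'.2⟩
      rw [apply_piMap_eq_of_mem_boundary hγ hφ (fun x _ => hθ.mem_Icc x)
        (snoc_mem_cube.2 ⟨hσ, moebiusFlow_mapsTo _ hτ⟩) (Or.inl ⟨i, by simpa using hi'⟩),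
        apply_piMap_eq_of_mem_boundary (θ := θ ∘ moebiusFlow c) hγ hφ (fun x _ => hθ.mem_Icc _)
        (snoc_mem_cube.2 ⟨hσ, hτ⟩) (Or.inl ⟨i, by simpa using hi'⟩)]
  intro p hp
  obtain ⟨σ, hσ, τ, hτ, rfl⟩ := exists_snoc_mem_cube hp
  rw [Function.comp_apply, shear_snoc]
  unfold juxtapose
  rw [snoc_zero, snoc_zero]
  split_ifs
  · exact key hγ₁ isProfile_leftProfile hθ₁ exchangeAmount_left hσ hτ
  · exact key hγ₂ isProfile_rightProfile hθ₂ exchangeAmount_right hσ hτ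

/-- The time change for the loop that runs first. -/
noncomputable def earlyTime (t : ℝ) : ℝ := ℓ * smoothStep (ℓ / 5) (2 * ℓ / 5) t

/-- The time change for the loop that runs second. -/
noncomputable def lateTime (t : ℝ) : ℝ := ℓ * smoothStep (3 * ℓ / 5) (4 * ℓ / 5) t

theorem isProfile_earlyTime : IsProfile earlyTime := by
  have := two_pi_pos
  exact isProfile_smoothStep (by linarith) (by linarith) (by linarith)

theorem isProfile_lateTime : IsProfile lateTime := by
  have := two_pi_pos
  exact isProfile_smoothStep (by linarith) (by linarith) (by linarith)

/-- At every time the second loop has not yet started or the first one is over. -/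
theorem eventually_lateTime_or_earlyTime (τ : ℝ) :
    (∀ᶠ t in nhdsWithin τ (Icc 0 ℓ), lateTime t = 0) ∨
      ∀ᶠ t in nhdsWithin τ (Icc 0 ℓ), earlyTime t = ℓ := by
  have := two_pi_pos
  rcases lt_or_ge τ (3 * ℓ / 5) with h | h
  · left
    filter_upwards [mem_nhdsWithin_of_mem_nhds (Iio_mem_nhds h)] with t ht
    rw [lateTime, smoothStep_eq_zero (by linarith) (le_of_lt ht), mul_zero]
  · right
    filter_upwards [mem_nhdsWithin_of_mem_nhds (Ioi_mem_nhds (show 2 * ℓ / 5 < τ by linarith))]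
      with t ht
    rw [earlyTime, smoothStep_eq_one (by linarith) (le_of_lt ht), mul_one]

/-- In the coordinate `y / (2π - y)` the early time change is active between `1 / 4` and `2 / 3` and
the late one between `3 / 2` and `4`. Multiplication by `16` and `1 / 16` moves these intervals to
`4, 32 / 3` and `3 / 32, 1 / 4`, which have the opposite order. -/
theorem eventually_earlyTime_or_lateTime_moebiusFlow (τ : ℝ) :
    (∀ᶠ t in nhdsWithin τ (Icc 0 ℓ), (earlyTime ∘ moebiusFlow (-Real.log 16)) t = 0) ∨
      ∀ᶠ t in nhdsWithin τ (Icc 0 ℓ), (lateTime ∘ moebiusFlow (Real.log 16)) t = ℓ := by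
  have := two_pi_pos
  have h16 : Real.exp (Real.log 16) = 16 := Real.exp_log (by norm_num)
  have h16' : Real.exp (-Real.log 16) = 1 / 16 := by rw [Real.exp_neg, h16]; norm_num
  -- The intervals `t < 4 / 5` and `1 / 5 < t`, in units of `2π`, cover all times.
  rcases lt_or_ge τ (4 * ℓ / 5) with h | h
  · left
    filter_upwards [mem_nhdsWithin_of_mem_nhds (Iio_mem_nhds h), self_mem_nhdsWithin] with t ht htI
    have hd := moebiusFlow_denom_pos (-Real.log 16) htI
    rw [Function.comp_apply, earlyTime, smoothStep_eq_zero (by linarith), mul_zero]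
    rw [moebiusFlow, div_le_iff₀ hd, h16']
    have ht' : t ≤ 4 * ℓ / 5 := le_of_lt ht
    nlinarith [mul_le_mul_of_nonneg_left ht' this.le]
  · right
    filter_upwards [mem_nhdsWithin_of_mem_nhds (Ioi_mem_nhds (show ℓ / 5 < τ by linarith)),
      self_mem_nhdsWithin] with t ht htI
    have hd := moebiusFlow_denom_pos (Real.log 16) htI
    rw [Function.comp_apply, lateTime, smoothStep_eq_one (by linarith), mul_one]
    rw [moebiusFlow, le_div_iff₀ hd, h16]
    have ht' : ℓ / 5 ≤ t := le_of_lt ht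
    nlinarith [mul_le_mul_of_nonneg_left ht' this.le]

/-- The juxtaposition of `γ₁` and `γ₂` has holonomy `g₂ * g₁` if `γ₁` runs first. The exchanging
shear turns it into a juxtaposition with holonomy `g₁ * g₂`. -/
theorem IsHolonomy.mul_comm {EM : Type*} [NormedAddCommGroup EM] [NormedSpace ℝ EM]
    {EP : Type*} [NormedAddCommGroup EP] [NormedSpace ℝ EP]
    {EG : Type*} [NormedAddCommGroup EG] [NormedSpace ℝ EG]
    {M : Type*} [TopologicalSpace M] [ChartedSpace EM M] [IsManifold 𝓘(ℝ, EM) ∞ M]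
    {P : Type*} [TopologicalSpace P] [ChartedSpace EP P] [IsManifold 𝓘(ℝ, EP) ∞ P]
    {G : Type*} [TopologicalSpace G] [ChartedSpace EG G] [Group G] [LieGroup 𝓘(ℝ, EG) ∞ G]
    {𝓟 : PrincipalBundle (EM := EM) (EP := EP) (EG := EG) M P G} {A : Connection 𝓟}
    {n : ℕ} [NeZero n] {B : AdForm 𝓟 (n + 1)} {u₀ : P} (hflat : IsRFlat A B u₀)
    {γ₁ γ₂ : (Fin (n + 1) → ℝ) → M} (hγ₁ : γ₁ ∈ LoopSpace (EM := EM) (𝓟.proj u₀) (n + 1))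
    (hγ₂ : γ₂ ∈ LoopSpace (EM := EM) (𝓟.proj u₀) (n + 1)) {g₁ g₂ : G}
    (hg₁ : IsHolonomy A B u₀ γ₁ g₁) (hg₂ : IsHolonomy A B u₀ γ₂ g₂) : g₁ * g₂ = g₂ * g₁ :=
  (hflat _ (juxtapose_mem_loopSpace hγ₁ hγ₂ isProfile_earlyTime isProfile_lateTime) _
    (isReparametrization_shear exchangeAmount_contDiff fun _ => exchangeAmount_eq_zero) _ _
    (isHolonomy_juxtapose hγ₁ hγ₂ isProfile_earlyTime.isTimeChange isProfile_lateTime.isTimeChange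
      (fun _ _ => rfl) (fun τ _ => eventually_lateTime_or_earlyTime τ) hg₁ hg₂)
    (isHolonomy_juxtapose' hγ₁ hγ₂ (isProfile_earlyTime.isTimeChange_comp_moebiusFlow _)
      (isProfile_lateTime.isTimeChange_comp_moebiusFlow _)
      (juxtapose_comp_shear hγ₁ hγ₂ isProfile_earlyTime isProfile_lateTime)
      (fun τ _ => eventually_earlyTime_or_lateTime_moebiusFlow τ) hg₁ hg₂)).symm

end LoopHolonomy

theorem mainTheorem2
    {EM : Type*} [NormedAddCommGroup EM] [NormedSpace ℝ EM] [FiniteDimensional ℝ EM]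
    {EP : Type*} [NormedAddCommGroup EP] [NormedSpace ℝ EP] [FiniteDimensional ℝ EP]
    {EG : Type*} [NormedAddCommGroup EG] [NormedSpace ℝ EG] [FiniteDimensional ℝ EG]
    {M : Type*} [TopologicalSpace M] [ChartedSpace EM M] [IsManifold 𝓘(ℝ, EM) ∞ M]
    {P : Type*} [TopologicalSpace P] [ChartedSpace EP P] [IsManifold 𝓘(ℝ, EP) ∞ P]
    {G : Type*} [TopologicalSpace G] [ChartedSpace EG G] [Group G] [LieGroup 𝓘(ℝ, EG) ∞ G]
    (𝓟 : LoopHolonomy.PrincipalBundle (EM := EM) (EP := EP) (EG := EG) M P G)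
    (A : LoopHolonomy.Connection 𝓟)
    (n : ℕ) [NeZero n] (B : LoopHolonomy.AdForm 𝓟 (n + 1)) (u₀ : P)
    (hflat : LoopHolonomy.IsRFlat A B u₀) :
    ∀ g ∈ LoopHolonomy.holonomyGroup A B u₀, ∀ h ∈ LoopHolonomy.holonomyGroup A B u₀,
      g * h = h * g := by
  have hcomm := Subgroup.isMulCommutative_closure
    (k := {g : G | ∃ γ ∈ LoopHolonomy.LoopSpace (EM := EM) (𝓟.proj u₀) (n + 1),
      LoopHolonomy.IsHolonomy A B u₀ γ g}) (by
    rintro g₁ ⟨γ₁, hγ₁, hg₁⟩ g₂ ⟨γ₂, hγ₂, hg₂⟩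
    exact LoopHolonomy.IsHolonomy.mul_comm hflat hγ₁ hγ₂ hg₁ hg₂)
  intro g hg h hh
  rw [LoopHolonomy.holonomyGroup] at hg hh
  exact setLike_mul_comm hg hh
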